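/- Let $F$ be a non-Archimedean local field of any characteristic, $\mathfrak o$ its ring of integers, $\pi$ a uniformizer, $\kappa$ the residue field and $\bar\kappa$ an algebraic closure of $\kappa$. Let $n\ge 4$ and let $$\phi(x)=x^n+c_1x^{n-1}+\cdots+c_n\in\mathfrak o[x]$$ be irreducible with $\mathrm{ord}(c_n)=2$. If $n$ is even, assume that $\phi_2(x)=x^2+\overline{c_{n/2}/\pi}\,x+\overline{c_n/\pi^2}$ is irreducible in $\kappa[x]$; if $n$ is odd, there is no such restriction. Let $0<l_1\le l_2$ be integers with $l_1+l_2=n-2$, and let $J_l$ be the nilpotent Jordan block of size $l$ with ones on the superdiagonal. Let $\mathrm{End}(L)_{M,l_1}$ and $\mathbb A_{l_1}$ be the affine spaces over $\mathfrak o$, of dimensions $n^2$ and $n$, which represent the following functors on flat $\mathfrak o$-algebras $R$: $$\mathrm{End}(L)_{M,l_1}(R)=\left\{\begin{pmatrix}\begin{pmatrix}J_{l_1}&0\\0&J_{l_2}\end{pmatrix}+\pi X_{11}&X_{12}\\ \pi X_{21}&\pi X_{22}\end{pmatrix}\in \mathrm M_n(R)\right\},\qquad \mathbb A_{l_1}(R)=(\pi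 R)^{l_2+1}\times(\pi^2R)^{n-l_2-1},$$ where $X_{11}$ has size $n-2$ and $X_{22}$ has size $2$. Let $\varphi_{l_1}:\mathrm{End}(L)_{M,l_1}\to\mathbb A_{l_1}$ be the morphism that sends $m$ to the tuple $(c_1(m),\dots,c_n(m))$ of coefficients of its characteristic polynomial $x^n+c_1(m)x^{n-1}+\cdots+c_n(m)$. Then $(c_1,\dots,c_n)\in\mathbb A_{l_1}(\mathfrak o)$, so that the scheme-theoretic fiber $\varphi_{l_1}^{-1}(\phi)$ over this section is defined, and: 1. for every $m\in\varphi_{l_1}^{-1}(\phi)(\bar\kappa)$, the map of Zariski tangent spaces $d(\varphi_{l_1})_m: T_m(\mathrm{End}(L)_{M,l_1}\otimes\bar\kappa)\to T_{\varphi_{l_1}(m)}(\mathbb A_{l_1}\otimes\bar\kappa)$ is surjective; 2. if $\phi$ is separable over $F$ (which is automatic if $\mathrm{char}(F)=0$ or $\mathrm{char}(F)>n$), then the scheme $\varphi_{l_1}^{-1}(\phi)$ is smooth over $\mathfrak o$. -/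

import Mathlib

open Polynomial ValuativeRel
open scoped DualNumber

universe u

namespace Smoothening

section Matrices

variable (l₁ l₂ : ℕ) (R : Type*) [CommRing R]

/-- Index set for rows and columns, of cardinality `n = l₁ + l₂ + 2`: the first two summands index
the block of size `n - 2 = l₁ + l₂`, the last summand the last two rows and columns. -/
abbrev Idx : Type := (Fin l₁ ⊕ Fin l₂) ⊕ Fin 2

/-- The nilpotent Jordan block of size `l`, with ones on the superdiagonal. -/
def jordanBlock (l : ℕ) : Matrix (Fin l) (Fin l) R :=
  Matrix.of fun i j => if (i : ℕ) + 1 = (j : ℕ) then 1 else 0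

variable {l₁ l₂ R}

/-- The matrix
`(J_{l₁} ⊥ J_{l₂} + p X₁₁, X₁₂; p X₂₁, p X₂₂)`
attached to a matrix `X = (X₁₁, X₁₂; X₂₁, X₂₂)`, where `X₁₁` has size `n - 2`
and `X₂₂` has size `2`. -/
def congruenceMatrix (p : R) (X : Matrix (Idx l₁ l₂) (Idx l₁ l₂) R) :
    Matrix (Idx l₁ l₂) (Idx l₁ l₂) R :=
  Matrix.fromBlocks
    (Matrix.fromBlocks (jordanBlock R l₁) 0 0 (jordanBlock R l₂) + p • X.toBlocks₁₁)
    X.toBlocks₁₂ (p • X.toBlocks₂₁) (p • X.toBlocks₂₂)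

/-- The coefficients `(c₁, …, cₙ)` of `xⁿ + c₁ xⁿ⁻¹ + ⋯ + cₙ`; the entry with index `i : Fin n`
is `c_{i+1}`. -/
def coeffVec (n : ℕ) (f : R[X]) : Fin n → R := fun i => f.coeff (n - 1 - i)

/-- The exponent of the uniformizer in the coordinate `c_{i+1}` of `𝔸_{l₁}`: it is `1` for the
first `l₂ + 1` coordinates and `2` for the others. -/
def expo (l₂ i : ℕ) : ℕ := if i ≤ l₂ then 1 else 2

end Matrices

section Functors

variable {o : Type*} [CommRing o] (π : o) (l₁ l₂ : ℕ)

/-- The set `End(L)_{M,l₁}(R)` of matrices over the `o`-algebra `R`. -/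
def EndPoints (R : Type*) [CommRing R] [Algebra o R] :
    Set (Matrix (Idx l₁ l₂) (Idx l₁ l₂) R) :=
  Set.range (congruenceMatrix (algebraMap o R π))

/-- The set `𝔸_{l₁}(R) = (πR)^{l₂+1} × (π²R)^{n-l₂-1}`. -/
def AffPoints (R : Type*) [CommRing R] [Algebra o R] : Set (Fin (l₁ + l₂ + 2) → R) :=
  {c | ∀ i : Fin (l₁ + l₂ + 2), algebraMap o R π ^ expo l₂ i ∣ c i}

end Functors

section WellDefined

variable {R : Type*} [CommRing R] {l₁ l₂ : ℕ}

/-- If `N` is nilpotent with `N ^ d = 0` over a domain, the coefficients of the characteristic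
polynomial of `N + p B` are divisible by `p`, and those of index larger than `d` by `p ^ 2`. -/
theorem dvd_coeff_charpolyRev [IsDomain R] {ι : Type*} [Fintype ι] [DecidableEq ι]
    (N B : Matrix ι ι R) (p : R) (d : ℕ) (hN : N ^ d = 0) (i : ℕ) (hi : 0 < i) :
    p ∣ (N + p • B).charpolyRev.coeff i ∧ (d < i → p ^ 2 ∣ (N + p • B).charpolyRev.coeff i) := by
  set N' : Matrix ι ι R[X] := (X : R[X]) • N.map C with hN'
  have hN'd : N' ^ d = 0 := by
    rw [hN', _root_.smul_pow, ← Matrix.map_pow, hN]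
    simp
  set U : Matrix ι ι R[X] := ∑ k ∈ Finset.range d, N' ^ k with hU
  have hU1 : (1 - N') * U = 1 := by
    rw [hU, mul_neg_geom_sum, hN'd, sub_zero]
  have hdet : (1 - N').det = 1 := by
    have hu : IsUnit (1 - N').det := by
      refine IsUnit.of_mul_eq_one U.det ?_
      rw [← Matrix.det_mul, hU1, Matrix.det_one]
    obtain ⟨a, -, ha⟩ := Polynomial.isUnit_iff.mp hu
    have h0 : (1 - N').det.eval 0 = 1 := by
      have := Matrix.eval_charpolyRev (M := N)
      rwa [Matrix.charpolyRev] at this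
    rw [← ha, eval_C] at h0
    rw [← ha, h0, C_1]
  have hfac : 1 - (X : R[X]) • (N + p • B).map C = (1 - N') * (1 + C p • (-((X : R[X]) • (U * B.map C)))) := by
    have h1 : (N + p • B).map C = N.map C + C p • B.map C := by
      ext i j : 2
      simp [Matrix.map_apply]
    rw [mul_add, mul_one, h1, smul_neg, mul_neg, mul_smul_comm, mul_smul_comm, ← mul_assoc, hU1,
      one_mul, smul_add, ← hN', smul_comm (X : R[X]) (C p)]
    abel
  have key : ∃ q : R[X], (N + p • B).charpolyRev =
      1 - C p * (X * (U * B.map C).trace) + C (p ^ 2) * q := by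
    have hexp := Matrix.det_one_add_smul (C p) (-((X : R[X]) • (U * B.map C)))
    rw [Matrix.trace_neg, Matrix.trace_smul, smul_eq_mul] at hexp
    rw [Matrix.charpolyRev, hfac, Matrix.det_mul, hdet, one_mul, hexp, C_pow]
    exact ⟨eval (C p) (1 + (X : R[X][X]) •
      (-((X : R[X]) • (U * B.map C))).map C).det.divX.divX, by ring⟩
  obtain ⟨q, hq⟩ := key
  have hi0 : (1 : R[X]).coeff i = 0 := by rw [coeff_one, if_neg (by omega)]
  obtain ⟨j, rfl⟩ : ∃ j, i = j + 1 := ⟨i - 1, by omega⟩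
  rw [hq, coeff_add, coeff_sub, hi0, coeff_C_mul, coeff_C_mul, coeff_X_mul]
  constructor
  · exact ⟨-(U * B.map C).trace.coeff j + p * q.coeff (j + 1), by ring⟩
  · intro hd
    have hz : (U * B.map C).trace.coeff j = 0 := by
      have hN'k : ∀ k, N' ^ k = (X : R[X]) ^ k • (N ^ k).map C := by
        intro k
        rw [hN', _root_.smul_pow, ← Matrix.map_pow]
      rw [hU, Finset.sum_mul, Matrix.trace_sum, finsetSum_coeff]
      refine Finset.sum_eq_zero fun k hk => ?_
      have hkd := Finset.mem_range.mp hk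
      rw [hN'k, smul_mul_assoc, ← Matrix.map_mul, Matrix.trace_smul, smul_eq_mul,
        mul_comm, coeff_mul_X_pow', if_pos (by omega), Matrix.trace, finsetSum_coeff]
      refine Finset.sum_eq_zero fun a _ => ?_
      rw [Matrix.diag_apply, Matrix.map_apply, coeff_C, if_neg (by omega)]
    rw [hz]
    exact ⟨q.coeff (j + 1), by ring⟩

theorem congruenceMatrix_eq (p : R) (X : Matrix (Idx l₁ l₂) (Idx l₁ l₂) R) :
    congruenceMatrix p X =
      Matrix.fromBlocks (Matrix.fromBlocks (jordanBlock R l₁) 0 0 (jordanBlock R l₂))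
        X.toBlocks₁₂ 0 0 +
      p • Matrix.fromBlocks X.toBlocks₁₁ 0 X.toBlocks₂₁ X.toBlocks₂₂ := by
  simp [congruenceMatrix, Matrix.fromBlocks_smul, Matrix.fromBlocks_add]

/-- The nilpotent part of `congruenceMatrix` has vanishing `(l₂ + 1)`-st power. -/
theorem nilpotentPart_pow (h : l₁ ≤ l₂) (Y : Matrix (Fin l₁ ⊕ Fin l₂) (Fin 2) R) :
    (Matrix.fromBlocks (Matrix.fromBlocks (jordanBlock R l₁) 0 0 (jordanBlock R l₂)) Y 0 0 :
      Matrix (Idx l₁ l₂) (Idx l₁ l₂) R) ^ (l₂ + 1) = 0 := by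
  set A : Matrix (Idx l₁ l₂) (Idx l₁ l₂) R :=
    Matrix.fromBlocks (Matrix.fromBlocks (jordanBlock R l₁) 0 0 (jordanBlock R l₂)) Y 0 0
  let ht : Idx l₁ l₂ → ℕ :=
    Sum.elim (Sum.elim (fun a => (a : ℕ) + (l₂ - l₁)) (fun a => (a : ℕ))) (fun _ => l₂)
  have hle : ∀ i, ht i ≤ l₂ := by
    rintro ((i | i) | i) <;> simp only [ht, Sum.elim_inl, Sum.elim_inr] <;> omega
  have hA : ∀ i j, A i j ≠ 0 → ht i + 1 ≤ ht j := by
    rintro ((i | i) | i) ((j | j) | j) hij <;>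
      simp [A, jordanBlock, Matrix.fromBlocks] at hij <;>
      simp only [ht, Sum.elim_inl, Sum.elim_inr] <;> omega
  have hpow : ∀ k i j, (A ^ k) i j ≠ 0 → ht i + k ≤ ht j := by
    intro k
    induction k with
    | zero =>
      intro i j hij
      rw [pow_zero, Matrix.one_apply] at hij
      have : i = j := by
        by_contra hne
        exact hij (if_neg hne)
      rw [this, add_zero]
    | succ k ih =>
      intro i j hij
      rw [pow_succ, Matrix.mul_apply] at hij
      obtain ⟨b, -, hb⟩ := Finset.exists_ne_zero_of_sum_ne_zero hij
      have h1 := ih i b (left_ne_zero_of_mul hb)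
      have h2 := hA b j (right_ne_zero_of_mul hb)
      omega
  ext i j
  by_contra hne
  have h1 := hpow _ i j hne
  have h2 := hle j
  omega

theorem expo_pow_dvd_of_isDomain [IsDomain R] (h : l₁ ≤ l₂) (p : R)
    (X : Matrix (Idx l₁ l₂) (Idx l₁ l₂) R) (i : Fin (l₁ + l₂ + 2)) :
    p ^ expo l₂ i ∣ coeffVec (l₁ + l₂ + 2) (congruenceMatrix p X).charpoly i := by
  have hcard : Fintype.card (Idx l₁ l₂) = l₁ + l₂ + 2 := by simp [Idx]
  have hcoef : (congruenceMatrix p X).charpoly.coeff (l₁ + l₂ + 2 - 1 - i) =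
      (congruenceMatrix p X).charpolyRev.coeff (i + 1) := by
    have hi := i.2
    rw [← Matrix.reverse_charpoly, coeff_reverse, Matrix.charpoly_natDegree_eq_dim, hcard,
      revAt_le (by omega)]
    congr 1
    omega
  have hdvd := dvd_coeff_charpolyRev _ (Matrix.fromBlocks X.toBlocks₁₁ 0 X.toBlocks₂₁ X.toBlocks₂₂)
    p (l₂ + 1) (nilpotentPart_pow h X.toBlocks₁₂) (i + 1) (by omega)
  rw [← congruenceMatrix_eq, ← hcoef] at hdvd
  rw [coeffVec, expo]
  split_ifs with hil
  · rw [pow_one]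
    exact hdvd.1
  · exact hdvd.2 (by omega)

end WellDefined

section Schemes

variable {o : Type u} [CommRing o] (π : o) {l₁ l₂ : ℕ}

variable (o l₁ l₂) in
/-- Coordinate ring of `End(L)_{M,l₁}`, an affine space of dimension `n ^ 2` over `o`; the
coordinates are the entries of the matrix `X` in `congruenceMatrix`. -/
abbrev EndRing : Type u := MvPolynomial (Idx l₁ l₂ × Idx l₁ l₂) o

variable (o l₁ l₂) in
/-- Coordinate ring of `𝔸_{l₁}`, an affine space of dimension `n` over `o`; the coordinates are
the `rᵢ` in `(π r₁, …, π r_{l₂+1}, π² r_{l₂+2}, …, π² rₙ)`. -/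
abbrev AffRing : Type u := MvPolynomial (Fin (l₁ + l₂ + 2)) o

variable (l₁ l₂) in
/-- The universal matrix of `End(L)_{M,l₁}`. -/
noncomputable def universalMatrix :
    Matrix (Idx l₁ l₂) (Idx l₁ l₂) (EndRing o l₁ l₂) :=
  congruenceMatrix (algebraMap o _ π) (Matrix.mvPolynomialX (Idx l₁ l₂) (Idx l₁ l₂) o)

/-- The `o`-algebra map sends the universal matrix to the matrix of the corresponding point. -/
theorem map_universalMatrix {R : Type*} [CommRing R] [Algebra o R]
    (f : EndRing o l₁ l₂ →ₐ[o] R) :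
    (universalMatrix π l₁ l₂).map f =
      congruenceMatrix (algebraMap o R π) (Matrix.of fun i j => f (MvPolynomial.X (i, j))) := by
  ext ((i | i) | i) ((j | j) | j) <;>
    simp [universalMatrix, congruenceMatrix, Matrix.fromBlocks, jordanBlock, Matrix.toBlocks₁₁,
      Matrix.toBlocks₁₂, Matrix.toBlocks₂₁, Matrix.toBlocks₂₂, apply_ite] <;>
    rw [Algebra.smul_def]

theorem coeffVec_universalMatrix_mem [IsDomain o] (h : l₁ ≤ l₂) :
    coeffVec (l₁ + l₂ + 2) (universalMatrix π l₁ l₂).charpoly ∈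
      AffPoints π l₁ l₂ (EndRing o l₁ l₂) :=
  fun i => expo_pow_dvd_of_isDomain (R := EndRing o l₁ l₂) h _ _ i

/-- The `o`-algebra homomorphism defining a point of `𝔸_{l₁}` with values in `R`. -/
noncomputable def affPoint {R : Type*} [CommRing R] [Algebra o R]
    {c : Fin (l₁ + l₂ + 2) → R} (hc : c ∈ AffPoints π l₁ l₂ R) : AffRing o l₁ l₂ →ₐ[o] R :=
  MvPolynomial.aeval fun i => (hc i).choose

theorem affPoint_spec {R : Type*} [CommRing R] [Algebra o R]
    {c : Fin (l₁ + l₂ + 2) → R} (hc : c ∈ AffPoints π l₁ l₂ R) (i : Fin (l₁ + l₂ + 2)) :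
    algebraMap o R π ^ expo l₂ i * affPoint π hc (MvPolynomial.X i) = c i := by
  rw [affPoint, MvPolynomial.aeval_X]
  exact (hc i).choose_spec.symm

/-- The comorphism of `φ_{l₁} : End(L)_{M,l₁} → 𝔸_{l₁}`, `m ↦` coefficients of the characteristic
polynomial of `m`: it is the point of `𝔸_{l₁}` given by the characteristic polynomial of the
universal matrix. -/
noncomputable def phiHom [IsDomain o] (h : l₁ ≤ l₂) :
    AffRing o l₁ l₂ →ₐ[o] EndRing o l₁ l₂ :=
  affPoint π (coeffVec_universalMatrix_mem π h)

/-- On points, `φ_{l₁}` is `m ↦` coefficients of the characteristic polynomial of `m`. -/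
theorem phiHom_spec [IsDomain o] (h : l₁ ≤ l₂) {R : Type*} [CommRing R] [Algebra o R]
    (f : EndRing o l₁ l₂ →ₐ[o] R) (i : Fin (l₁ + l₂ + 2)) :
    algebraMap o R π ^ expo l₂ i * (f.comp (phiHom π h)) (MvPolynomial.X i) =
      coeffVec (l₁ + l₂ + 2) ((universalMatrix π l₁ l₂).map f).charpoly i := by
  have hspec := affPoint_spec π (coeffVec_universalMatrix_mem π (o := o) h) i
  have hmap : ((universalMatrix π l₁ l₂).map f).charpoly =
      (universalMatrix π l₁ l₂).charpoly.map (f : EndRing o l₁ l₂ →+* R) :=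
    Matrix.charpoly_map (universalMatrix π l₁ l₂) (f : EndRing o l₁ l₂ →+* R)
  rw [hmap, coeffVec, coeff_map]
  have := congrArg f hspec
  rw [map_mul, map_pow, AlgHom.commutes] at this
  exact this

theorem isSMulRegular_of_flat [IsDomain o] (hπ : π ≠ 0) (R : Type*) [CommRing R] [Algebra o R]
    [Module.Flat o R] {x y : R} (h : algebraMap o R π * x = algebraMap o R π * y) : x = y := by
  refine Module.Flat.isSMulRegular_of_nonZeroDivisors (M := R)
    (mem_nonZeroDivisors_of_ne_zero hπ) ?_
  simpa [Algebra.smul_def] using h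

/-- `EndRing` represents the functor `End(L)_{M,l₁}` on flat `o`-algebras. -/
theorem endRing_represents [IsDomain o] (hπ : π ≠ 0) (R : Type*) [CommRing R] [Algebra o R]
    [Module.Flat o R] :
    Set.BijOn (fun f : EndRing o l₁ l₂ →ₐ[o] R => (universalMatrix π l₁ l₂).map f)
      Set.univ (EndPoints π l₁ l₂ R) := by
  refine ⟨fun f _ => ?_, fun f _ g _ hfg => ?_, ?_⟩
  · exact ⟨_, (map_universalMatrix π f).symm⟩
  · simp only [map_universalMatrix] at hfg
    refine MvPolynomial.algHom_ext fun ⟨i, j⟩ => ?_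
    have hij := congrFun (congrFun hfg i) j
    rcases i with (i | i) | i <;> rcases j with (j | j) | j <;>
      simp only [congruenceMatrix, Matrix.fromBlocks, Matrix.toBlocks₁₁, Matrix.toBlocks₁₂,
        Matrix.toBlocks₂₁, Matrix.toBlocks₂₂, Matrix.of_apply, Sum.elim_inl, Sum.elim_inr,
        Matrix.add_apply, Matrix.smul_apply, smul_eq_mul, add_right_inj] at hij <;>
      first
        | exact hij
        | exact isSMulRegular_of_flat π hπ R hij
  · rintro _ ⟨Y, rfl⟩
    refine ⟨MvPolynomial.aeval fun ij => Y ij.1 ij.2, Set.mem_univ _, ?_⟩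
    simp only [map_universalMatrix, MvPolynomial.aeval_X]
    rfl

/-- `AffRing` represents the functor `𝔸_{l₁}` on flat `o`-algebras. -/
theorem affRing_represents [IsDomain o] (hπ : π ≠ 0) (R : Type*) [CommRing R] [Algebra o R]
    [Module.Flat o R] :
    Set.BijOn (fun (f : AffRing o l₁ l₂ →ₐ[o] R) (i : Fin (l₁ + l₂ + 2)) =>
      algebraMap o R π ^ expo l₂ i * f (MvPolynomial.X i))
      Set.univ (AffPoints π l₁ l₂ R) := by
  refine ⟨fun f _ i => ⟨_, rfl⟩, fun f _ g _ hfg => ?_, fun c hc => ?_⟩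
  · refine MvPolynomial.algHom_ext fun i => ?_
    have hi := congrFun hfg i
    simp only [← map_pow] at hi
    exact isSMulRegular_of_flat _ (pow_ne_zero _ hπ) R hi
  · exact ⟨affPoint π hc, Set.mem_univ _, funext fun i => affPoint_spec π hc i⟩

open AlgebraicGeometry CategoryTheory CategoryTheory.Limits

variable (o l₁ l₂) in
/-- The scheme `End(L)_{M,l₁}`. -/
noncomputable def EndScheme : Scheme.{u} := Spec (CommRingCat.of (EndRing o l₁ l₂))

variable (o l₁ l₂) in
/-- The scheme `𝔸_{l₁}`. -/
noncomputable def AffScheme : Scheme.{u} := Spec (CommRingCat.of (AffRing o l₁ l₂))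

/-- The morphism `φ_{l₁} : End(L)_{M,l₁} → 𝔸_{l₁}`. -/
noncomputable def phiMor [IsDomain o] (h : l₁ ≤ l₂) : EndScheme o l₁ l₂ ⟶ AffScheme o l₁ l₂ :=
  Spec.map (CommRingCat.ofHom (phiHom π h).toRingHom)

/-- The section `Spec o → 𝔸_{l₁}` given by an element of `𝔸_{l₁}(o)`. -/
noncomputable def affSection {c : Fin (l₁ + l₂ + 2) → o} (hc : c ∈ AffPoints π l₁ l₂ o) :
    Spec (CommRingCat.of o) ⟶ AffScheme o l₁ l₂ :=
  Spec.map (CommRingCat.ofHom (affPoint π hc).toRingHom)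

/-- The scheme-theoretic fiber `φ_{l₁}⁻¹(c)` over an element `c` of `𝔸_{l₁}(o)`. -/
noncomputable def fiber [IsDomain o] (h : l₁ ≤ l₂) {c : Fin (l₁ + l₂ + 2) → o}
    (hc : c ∈ AffPoints π l₁ l₂ o) : Scheme.{u} :=
  pullback (phiMor π h) (affSection π hc)

/-- The structure morphism `φ_{l₁}⁻¹(c) → Spec o`. -/
noncomputable def fiberToSpec [IsDomain o] (h : l₁ ≤ l₂) {c : Fin (l₁ + l₂ + 2) → o}
    (hc : c ∈ AffPoints π l₁ l₂ o) : fiber π h hc ⟶ Spec (CommRingCat.of o) :=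
  pullback.snd (phiMor π h) (affSection π hc)

end Schemes

section Tangent

variable {o A B k : Type*} [CommRing o] [CommRing A] [Algebra o A] [CommRing B] [Algebra o B]
  [Field k] [Algebra o k]

/-- The tangent space of `Spec B ⊗ₒ k` at a `k`-valued point `m` over `o`: the points with values
in the dual numbers `k[ε]` which reduce to `m`. -/
def TangentSpaceAt (m : B →ₐ[o] k) : Type _ :=
  {s : B →ₐ[o] k[ε] // ∀ b, (s b).fst = m b}

/-- The map on tangent spaces at `m` induced by the morphism with comorphism `ψ : A → B`. -/
def tangentMap (ψ : A →ₐ[o] B) (m : B →ₐ[o] k) :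
    TangentSpaceAt m → TangentSpaceAt (m.comp ψ) :=
  fun s => ⟨s.1.comp ψ, fun a => s.2 (ψ a)⟩

end Tangent

end Smoothening

/-! On the special fiber everything reduces to a square linear system. Write the universal matrix as
`N + π B`, with `N` nilpotent and `N ^ (l₂ + 1) = 0`. With `U` the geometric series of `t N`, one
has `1 - t (N + π B) = (1 - t N) (1 + π P)`, where `P = -t U B` and `det (1 - t N) = 1`. Expanding
in `π` shows that modulo `π` the first `l₂ + 1` coordinates of the morphism are the traces `-tr (N ^
i B)`, and the others are coefficients of the second elementary invariant of `P`
(`charpolyRev_add_smul`, `phiHom_special_low`, `phiHom_special_high`).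

It suffices to move along rank-one directions `z wᵀ` with a fixed covector `w` supported at the
heads of the Jordan blocks. These leave `N` unchanged, and the coordinates change exactly linearly
in `z`, so surjectivity becomes injectivity of a map between spaces of dimension `n`. If `z` is in
the kernel and `N ^ b z` is the last nonzero iterate, then `N ^ b z` lies in `ker N`, which is
spanned by heads, say with coefficients `u`. For `b ≤ l₁` the equations reduce to `w · u = 0` and `w
· M u = 0` for a 2 × 2 matrix `M`; for `b > l₁` both `w` and `u` live on the longer block, and `w ·
u = 0` suffices (`eq_zero_of_moments`).

A good `w` exists unless `M` is degenerate. Here `det M` is the residue of `c_n / π²`, a unit. If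
`l₁ < l₂`, the Newton polygon gives `π² ∣ c_{l₂ + 1}`, which kills one diagonal entry of `M` and
forces an off-diagonal one to be nonzero. If `l₁ = l₂`, a scalar `M` would make `φ₂` a square over
an extension of the finite field `κ`, against its separability (`exists_covector`).

At points where `π` is invertible, separability of `φ` yields a basis of left eigenvectors. Their
sum plays the role of `w` (`exists_charpolyVariation_injective`). Smoothness then follows from the
Jacobian criterion, tested at all field-valued points of the fiber. -/

namespace Smoothening

/-! ### Jacobian criterion for complete intersections in affine space. -/

section JacobianCriterion

/-- First order Taylor expansion of a polynomial along a square-zero ideal. -/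
theorem aeval_add_of_sq_eq_bot {R A σ : Type*} [CommRing R] [CommRing A] [Algebra R A] [Fintype σ]
    {I : Ideal A} (hI : I ^ 2 = ⊥) (x h : σ → A) (hh : ∀ a, h a ∈ I) (f : MvPolynomial σ R) :
    MvPolynomial.aeval (fun a => x a + h a) f = MvPolynomial.aeval x f + ∑ a, h a * MvPolynomial.aeval x (MvPolynomial.pderiv a f) := by
  classical
  induction f using MvPolynomial.induction_on with
  | C r => simp
  | add p q hp hq =>
    simp only [map_add, hp, hq, mul_add, Finset.sum_add_distrib]
    ring
  | mul_X p b hp =>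
    have h0 : (∑ a, h a * MvPolynomial.aeval x (MvPolynomial.pderiv a p)) * h b = 0 := by
      have : (∑ a, h a * MvPolynomial.aeval x (MvPolynomial.pderiv a p)) * h b ∈ I ^ 2 := by
        rw [pow_two]
        exact Ideal.mul_mem_mul (Ideal.sum_mem _ fun a _ => I.mul_mem_right _ (hh a)) (hh b)
      rwa [hI, Ideal.mem_bot] at this
    have h1 : ∑ a, h a * MvPolynomial.aeval x (MvPolynomial.pderiv a (p * MvPolynomial.X b)) =
        MvPolynomial.aeval x p * h b + (∑ a, h a * MvPolynomial.aeval x (MvPolynomial.pderiv a p)) * x b := by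
      have : ∀ a, h a * MvPolynomial.aeval x (MvPolynomial.pderiv a (p * MvPolynomial.X b)) =
          (if a = b then MvPolynomial.aeval x p * h b else 0) + (h a * MvPolynomial.aeval x (MvPolynomial.pderiv a p)) * x b := by
        intro a
        rw [Derivation.leibniz, MvPolynomial.pderiv_X, Pi.single_apply]
        by_cases hab : b = a
        · subst hab
          simp
          ring
        · rw [if_neg hab, if_neg (Ne.symm hab)]
          simp
          ring
      rw [Finset.sum_congr rfl fun a _ => this a, Finset.sum_add_distrib, Finset.sum_mul]
      simp
    rw [h1, map_mul, map_mul, MvPolynomial.aeval_X, MvPolynomial.aeval_X, hp]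
    linear_combination h0

/-- A matrix whose rows stay linearly independent modulo every maximal ideal has a right
inverse. -/
theorem exists_mul_eq_one_of_forall_maximal {C ι σ : Type*} [CommRing C] [Fintype ι]
    [DecidableEq ι] [Fintype σ] (J : Matrix ι σ C)
    (h : ∀ (m : Ideal C) [m.IsMaximal] (v : ι → C ⧸ m),
      (∀ a, ∑ i, v i * Ideal.Quotient.mk m (J i a) = 0) → v = 0) :
    ∃ B : Matrix σ ι C, J * B = 1 := by
  classical
  -- Otherwise the column space lies in a maximal proper submodule `N`. The quotient by `N` is some
  -- `C ⧸ m`, which gives a nonzero functional modulo `m` killing every column.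
  have hsurj : LinearMap.range J.mulVecLin = ⊤ := by
    by_contra hne
    obtain ⟨N, hN, hle⟩ := (eq_top_or_exists_le_coatom (LinearMap.range J.mulVecLin)).resolve_left
      hne
    have hs : IsSimpleModule C ((ι → C) ⧸ N) := isSimpleModule_iff_isCoatom.mpr hN
    obtain ⟨m, hm, ⟨e⟩⟩ := isSimpleModule_iff_quot_maximal.mp hs
    set ℓ : (ι → C) →ₗ[C] C ⧸ m := e.toLinearMap ∘ₗ N.mkQ with hℓ
    have happ : ∀ w : ι → C, ℓ w = ∑ i, ℓ (Pi.single i 1) * Ideal.Quotient.mk m (w i) := by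
      intro w
      conv_lhs => rw [pi_eq_sum_univ' w, map_sum]
      refine Finset.sum_congr rfl fun i _ => ?_
      rw [map_smul, Algebra.smul_def, mul_comm]
      rfl
    have hv : (fun i => ℓ (Pi.single i 1)) = 0 := by
      refine h m _ fun a => ?_
      have hmem : (fun i => J i a) ∈ N := by
        refine hle ⟨Pi.single a 1, ?_⟩
        ext i
        simp
      have h0 : ℓ (fun i => J i a) = 0 := by
        rw [hℓ, LinearMap.comp_apply, Submodule.mkQ_apply,
          (Submodule.Quotient.mk_eq_zero N).mpr hmem, map_zero]
      rw [happ] at h0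
      exact h0
    refine hN.1 (eq_top_iff.mpr fun w _ => ?_)
    have hw : ℓ w = 0 := by
      rw [happ]
      exact Finset.sum_eq_zero fun i _ => by rw [congrFun hv i]; simp
    rw [hℓ, LinearMap.comp_apply, LinearEquiv.coe_coe, LinearEquiv.map_eq_zero_iff] at hw
    exact (Submodule.Quotient.mk_eq_zero N).mp hw
  choose b hb using fun i => LinearMap.range_eq_top.mp hsurj (Pi.single i 1)
  refine ⟨Matrix.of fun a i => b i a, ?_⟩
  ext i j
  have := congrFun (hb j) i
  rw [Matrix.mulVecLin_apply, Pi.single_apply] at this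
  rw [Matrix.one_apply, ← this]
  rfl

/-- The Jacobian criterion for smoothness of a complete intersection in an affine space. -/
theorem smooth_quotient_of_jacobian {o : Type u} [CommRing o] {σ ι : Type} [Fintype σ] [Fintype ι]
    (r : ι → MvPolynomial σ o)
    (h : ∀ (K : Type u) [Field K] [Algebra o K] (x : MvPolynomial σ o →ₐ[o] K),
      (∀ i, x (r i) = 0) →
      ∀ v : ι → K, (∀ a, ∑ i, v i * x (MvPolynomial.pderiv a (r i)) = 0) → v = 0) :
    Algebra.Smooth o (MvPolynomial σ o ⧸ Ideal.span (Set.range r)) := by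
  classical
  set I₀ := Ideal.span (Set.range r) with hI₀
  have hfp : Algebra.FinitePresentation o (MvPolynomial σ o ⧸ I₀) :=
    Algebra.FinitePresentation.quotient (Submodule.fg_span (Set.finite_range r))
  refine ⟨?_, hfp⟩
  obtain ⟨B₀, hB₀⟩ := exists_mul_eq_one_of_forall_maximal
    (Matrix.of fun (i : ι) (a : σ) => Ideal.Quotient.mk I₀ (MvPolynomial.pderiv a (r i))) (by
      intro m hm v hv
      let _ := Ideal.Quotient.field m
      refine h (_ ⧸ m) ((Ideal.Quotient.mkₐ o m).comp (Ideal.Quotient.mkₐ o I₀)) (fun i => ?_) v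
        (fun a => hv a)
      have : Ideal.Quotient.mk I₀ (r i) = 0 :=
        Ideal.Quotient.eq_zero_iff_mem.mpr (Ideal.subset_span ⟨i, rfl⟩)
      simp [this])
  choose ρ hρ using fun a i => Ideal.Quotient.mk_surjective (B₀ a i)
  refine Algebra.FormallySmooth.of_comp_surjective fun B _ _ I hI g => ?_
  set q := Ideal.Quotient.mkₐ o I₀ with hq
  choose x hx using fun a => Ideal.Quotient.mk_surjective (g (q (MvPolynomial.X a)))
  have hlift : ∀ f, Ideal.Quotient.mk I (MvPolynomial.aeval x f) = g (q f) := by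
    intro f
    have : (Ideal.Quotient.mkₐ o I).comp (MvPolynomial.aeval x) = g.comp q := by
      refine MvPolynomial.algHom_ext fun a => ?_
      simpa using hx a
    exact DFunLike.congr_fun this f
  have hr : ∀ i, MvPolynomial.aeval x (r i) ∈ I := by
    intro i
    rw [← Ideal.Quotient.eq_zero_iff_mem, hlift]
    have : q (r i) = 0 := Ideal.Quotient.eq_zero_iff_mem.mpr (Ideal.subset_span ⟨i, rfl⟩)
    rw [this, map_zero]
  -- One Newton step: `ρ` lifts a right inverse of the Jacobian `J`, so `r (x + δ) = (1 - J ρ)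
  -- r(x)`. Both factors have entries in `I`, and `I ^ 2 = ⊥`.
  set δ : σ → B := fun a => -∑ j, MvPolynomial.aeval x (ρ a j) * MvPolynomial.aeval x (r j) with hδ
  have hδI : ∀ a, δ a ∈ I := fun a =>
    I.neg_mem (Ideal.sum_mem _ fun j _ => I.mul_mem_left _ (hr j))
  have hmat : ∀ i j, ∑ a, MvPolynomial.aeval x (MvPolynomial.pderiv a (r i)) * MvPolynomial.aeval x (ρ a j) - (1 : Matrix ι ι B) i j ∈
      I := by
    intro i j
    rw [← Ideal.Quotient.eq_zero_iff_mem, map_sub, map_sum]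
    have h1 := congrArg g (congrFun (congrFun hB₀ i) j)
    rw [Matrix.mul_apply, map_sum] at h1
    rw [sub_eq_zero]
    refine Eq.trans (Finset.sum_congr rfl fun a _ => ?_) (h1.trans ?_)
    · rw [map_mul, map_mul, hlift, hlift, ← hρ a j]
      rfl
    · rw [Matrix.one_apply, Matrix.one_apply]
      split_ifs <;> simp
  have hzero : ∀ i, MvPolynomial.aeval (fun a => x a + δ a) (r i) = 0 := by
    intro i
    rw [aeval_add_of_sq_eq_bot hI x δ hδI]
    have h1 : ∑ a, δ a * MvPolynomial.aeval x (MvPolynomial.pderiv a (r i)) =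
        -∑ j, (∑ a, MvPolynomial.aeval x (MvPolynomial.pderiv a (r i)) * MvPolynomial.aeval x (ρ a j)) * MvPolynomial.aeval x (r j) := by
      simp only [hδ, neg_mul, Finset.sum_mul, Finset.sum_neg_distrib]
      rw [Finset.sum_comm]
      congr 1
      exact Finset.sum_congr rfl fun j _ => Finset.sum_congr rfl fun a _ => by ring
    have h2 : MvPolynomial.aeval x (r i) = ∑ j, (1 : Matrix ι ι B) i j * MvPolynomial.aeval x (r j) := by
      simp [Matrix.one_apply]
    rw [h1]
    nth_rewrite 1 [h2]
    rw [← sub_eq_add_neg, ← Finset.sum_sub_distrib]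
    refine Finset.sum_eq_zero fun j _ => ?_
    rw [← sub_mul]
    have : (((1 : Matrix ι ι B) i j - ∑ a, MvPolynomial.aeval x (MvPolynomial.pderiv a (r i)) * MvPolynomial.aeval x (ρ a j))) *
        MvPolynomial.aeval x (r j) ∈ I ^ 2 := by
      rw [pow_two]
      refine Ideal.mul_mem_mul ?_ (hr j)
      rw [← neg_sub]
      exact I.neg_mem (hmat i j)
    rwa [hI, Ideal.mem_bot] at this
  have hle : I₀ ≤ RingHom.ker
      (MvPolynomial.aeval fun a => x a + δ a : MvPolynomial σ o →ₐ[o] B) := by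
    rw [hI₀, Ideal.span_le, Set.range_subset_iff]
    exact hzero
  refine ⟨Ideal.Quotient.liftₐ I₀ (MvPolynomial.aeval fun a => x a + δ a) hle, ?_⟩
  · refine Ideal.Quotient.algHom_ext _ (MvPolynomial.algHom_ext fun a => ?_)
    have h0 : Ideal.Quotient.mk I (δ a) = 0 := Ideal.Quotient.eq_zero_iff_mem.mpr (hδI a)
    change Ideal.Quotient.mk I (MvPolynomial.aeval _ (MvPolynomial.X a)) = _
    rw [MvPolynomial.aeval_X, map_add, h0, add_zero, hx]
    rfl

end JacobianCriterion

/-! ### Smoothness of a fiber from surjectivity of tangent maps. -/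

section FiberSmooth

open AlgebraicGeometry CategoryTheory CategoryTheory.Limits

/-- If tangent maps are surjective at all points of the fiber over `c`, the Jacobian matrix has
independent rows there. -/
theorem jacobian_of_tangentMap_surjective {o : Type*} [CommRing o] {σ ι : Type} [Fintype σ]
    [Fintype ι] (ψ : MvPolynomial ι o →ₐ[o] MvPolynomial σ o) {k : Type*} [Field k] [Algebra o k]
    (x : MvPolynomial σ o →ₐ[o] k) (hx : Function.Surjective (tangentMap ψ x)) (v : ι → k)
    (hv : ∀ a, ∑ i, v i * x (MvPolynomial.pderiv a (ψ (MvPolynomial.X i))) = 0) : v = 0 := by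
  classical
  funext i₀
  obtain ⟨s, hs⟩ := hx ⟨MvPolynomial.aeval fun i => TrivSqZeroExt.inl (x (ψ (MvPolynomial.X i))) +
    TrivSqZeroExt.inr ((Pi.single i₀ 1 : ι → k) i), by
      intro b
      have : (TrivSqZeroExt.fstHom o k k).comp (MvPolynomial.aeval fun i => TrivSqZeroExt.inl (x (ψ (MvPolynomial.X i))) +
          TrivSqZeroExt.inr ((Pi.single i₀ 1 : ι → k) i)) = x.comp ψ := by
        refine MvPolynomial.algHom_ext fun i => ?_
        simp
      exact DFunLike.congr_fun this b⟩
  have key : ∀ i, ∑ a, (s.1 (MvPolynomial.X a)).snd * x (MvPolynomial.pderiv a (ψ (MvPolynomial.X i))) = (Pi.single i₀ 1 : ι → k) i := by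
    intro i
    set I : Ideal k[ε] := RingHom.ker (TrivSqZeroExt.fstHom o k k) with hI
    have hI2 : I ^ 2 = ⊥ := by
      rw [pow_two, eq_bot_iff, Ideal.mul_le]
      intro a ha b hb
      rw [hI, RingHom.mem_ker, TrivSqZeroExt.fstHom_apply] at ha hb
      rw [Ideal.mem_bot]
      ext <;> simp [ha, hb]
    have hsx : s.1 = MvPolynomial.aeval (fun a => TrivSqZeroExt.inl (x (MvPolynomial.X a)) +
        TrivSqZeroExt.inr (s.1 (MvPolynomial.X a)).snd) := by
      refine MvPolynomial.algHom_ext fun a => ?_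
      rw [MvPolynomial.aeval_X, ← s.2, TrivSqZeroExt.inl_fst_add_inr_snd_eq]
    have hinl : ∀ f, MvPolynomial.aeval (fun a => (TrivSqZeroExt.inl (x (MvPolynomial.X a)) : k[ε])) f =
        TrivSqZeroExt.inl (x f) := by
      intro f
      have : MvPolynomial.aeval (fun a => (TrivSqZeroExt.inl (x (MvPolynomial.X a)) : k[ε])) =
          (TrivSqZeroExt.inlAlgHom o k k).comp x := by
        refine MvPolynomial.algHom_ext fun a => ?_
        simp
      exact DFunLike.congr_fun this f
    have h1 := aeval_add_of_sq_eq_bot hI2 (fun a => (TrivSqZeroExt.inl (x (MvPolynomial.X a)) : k[ε]))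
      (fun a => TrivSqZeroExt.inr (s.1 (MvPolynomial.X a)).snd) (fun a => by simp [hI, RingHom.mem_ker])
      (ψ (MvPolynomial.X i))
    rw [← hsx] at h1
    have h2 := DFunLike.congr_fun (congrArg Subtype.val hs) (MvPolynomial.X i)
    change s.1 (ψ (MvPolynomial.X i)) = _ at h2
    rw [MvPolynomial.aeval_X] at h2
    rw [h2] at h1
    have h3 := congrArg TrivSqZeroExt.snd h1
    simp only [hinl, TrivSqZeroExt.snd_add, TrivSqZeroExt.snd_inl, TrivSqZeroExt.snd_inr, zero_add,
      TrivSqZeroExt.snd_sum, TrivSqZeroExt.inr_mul_inl] at h3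
    rw [h3]
    exact Finset.sum_congr rfl fun a _ => by simp
  -- Since `s` lifts the `i₀`-th coordinate vector, pairing `v` with the Jacobian applied to `s`
  -- reads off `v i₀`.
  have h4 : ∑ a, (s.1 (MvPolynomial.X a)).snd * ∑ i, v i * x (MvPolynomial.pderiv a (ψ (MvPolynomial.X i))) = v i₀ := by
    calc _ = ∑ i, v i * ∑ a, (s.1 (MvPolynomial.X a)).snd * x (MvPolynomial.pderiv a (ψ (MvPolynomial.X i))) := by
          simp only [Finset.mul_sum]
          rw [Finset.sum_comm]
          exact Finset.sum_congr rfl fun i _ => Finset.sum_congr rfl fun a _ => by ring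
      _ = v i₀ := by simp [key, Pi.single_apply]
  rw [← h4]
  simp [hv]

/-- The fiber of a morphism of affine spaces over a section is the spectrum of a quotient of the
polynomial ring; it is smooth if all tangent maps at its points are surjective. -/
theorem smooth_pullback_of_tangentMap_surjective {o : Type u} [CommRing o] {σ ι : Type} [Fintype σ]
    [Fintype ι] (ψ : MvPolynomial ι o →ₐ[o] MvPolynomial σ o) (c : MvPolynomial ι o →ₐ[o] o)
    (h : ∀ (K : Type u) [Field K] [IsAlgClosed K] [Algebra o K] (x : MvPolynomial σ o →ₐ[o] K),
      x.comp ψ = (Algebra.ofId o K).comp c → Function.Surjective (tangentMap ψ x)) :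
    AlgebraicGeometry.Smooth (pullback.snd
      (Spec.map (CommRingCat.ofHom ψ.toRingHom)) (Spec.map (CommRingCat.ofHom c.toRingHom))) := by
  set r : ι → MvPolynomial σ o := fun i => ψ (MvPolynomial.X i) - MvPolynomial.C (c (MvPolynomial.X i)) with hr
  have hsm := smooth_quotient_of_jacobian r (by
    intro K _ _ x hx v hv
    -- The criterion tests arbitrary fields and the hypothesis only algebraically closed ones;
    -- independence of the rows descends along `K → AlgebraicClosure K`.
    let y : MvPolynomial σ o →ₐ[o] AlgebraicClosure K :=
      (IsScalarTower.toAlgHom o K (AlgebraicClosure K)).comp x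
    have hy := h (AlgebraicClosure K) y (by
      refine MvPolynomial.algHom_ext fun i => ?_
      have h1 := hx i
      simp only [hr, map_sub, sub_eq_zero] at h1
      simp only [y, AlgHom.comp_apply, h1, Algebra.ofId_apply]
      rw [← MvPolynomial.algebraMap_eq, AlgHom.commutes, AlgHom.commutes])
    have h2 := jacobian_of_tangentMap_surjective ψ y hy (fun i => algebraMap K _ (v i)) (by
      intro a
      have h3 := congrArg (algebraMap K (AlgebraicClosure K)) (hv a)
      simp only [hr, map_sub, MvPolynomial.pderiv_C, sub_zero, map_sum, map_mul, map_zero] at h3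
      exact h3)
    funext i
    have h4 := congrFun h2 i
    simpa using h4)
  set I₀ := Ideal.span (Set.range r) with hI₀
  have hmem : ∀ f, Ideal.Quotient.mk I₀ (ψ f) = algebraMap o _ (c f) := by
    intro f
    have : (Ideal.Quotient.mkₐ o I₀).comp ψ = (Algebra.ofId o _).comp c := by
      refine MvPolynomial.algHom_ext fun i => ?_
      have h1 : Ideal.Quotient.mk I₀ (r i) = 0 :=
        Ideal.Quotient.eq_zero_iff_mem.mpr (Ideal.subset_span ⟨i, rfl⟩)
      rw [hr, map_sub, sub_eq_zero] at h1
      exact h1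
    exact DFunLike.congr_fun this f
  -- The fiber has coordinate ring `o[X] / (ψ(Xᵢ) - c(Xᵢ))`: modulo these relations `ψ` factors
  -- through `c`, universally so.
  have hpo : IsPushout (CommRingCat.ofHom ψ.toRingHom) (CommRingCat.ofHom c.toRingHom)
      (CommRingCat.ofHom (Ideal.Quotient.mk I₀))
      (CommRingCat.ofHom (algebraMap o (MvPolynomial σ o ⧸ I₀))) := by
    refine ⟨⟨?_⟩, ⟨PushoutCocone.IsColimit.mk _ (fun s => CommRingCat.ofHom
      (Ideal.Quotient.lift I₀ s.inl.hom ?_)) ?_ ?_ ?_⟩⟩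
    · exact CommRingCat.hom_ext (RingHom.ext hmem)
    · intro a ha
      have hle : I₀ ≤ RingHom.ker s.inl.hom := by
        rw [hI₀, Ideal.span_le]
        rintro _ ⟨i, rfl⟩
        have h1 := ConcreteCategory.congr_hom s.condition (MvPolynomial.X i)
        have h2 := ConcreteCategory.congr_hom s.condition (MvPolynomial.C (c (MvPolynomial.X i)))
        have h3 : ψ (MvPolynomial.C (c (MvPolynomial.X i))) = MvPolynomial.C (c (MvPolynomial.X i)) := AlgHom.commutes ψ _
        have h4 : c (MvPolynomial.C (c (MvPolynomial.X i))) = c (MvPolynomial.X i) := AlgHom.commutes c _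
        change s.inl.hom (ψ _) = s.inr.hom (c _) at h1 h2
        rw [h3, h4] at h2
        rw [SetLike.mem_coe, RingHom.mem_ker, hr, map_sub, h1, h2, sub_self]
      exact hle ha
    · intro s
      exact CommRingCat.hom_ext (RingHom.ext fun f => rfl)
    · intro s
      refine CommRingCat.hom_ext (RingHom.ext fun a => ?_)
      have h2 := ConcreteCategory.congr_hom s.condition (MvPolynomial.C a)
      have h3 : ψ (MvPolynomial.C a) = MvPolynomial.C a := AlgHom.commutes ψ _
      have h4 : c (MvPolynomial.C a) = a := AlgHom.commutes c _
      change s.inl.hom (ψ _) = s.inr.hom (c _) at h2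
      rw [h3, h4] at h2
      exact h2
    · intro s m hm1 hm2
      refine CommRingCat.hom_ext (RingHom.ext fun f => ?_)
      obtain ⟨f, rfl⟩ := Ideal.Quotient.mk_surjective f
      exact ConcreteCategory.congr_hom hm1 f
  have hpb := isPullback_SpecMap_of_isPushout _ _ _ _ hpo
  have hS : AlgebraicGeometry.Smooth
      (Spec.map (CommRingCat.ofHom (algebraMap o (MvPolynomial σ o ⧸ I₀)))) := by
    rw [HasRingHomProperty.Spec_iff (P := @AlgebraicGeometry.Smooth)]
    exact RingHom.smooth_algebraMap.mpr hsm
  rw [← hpb.isoPullback_inv_snd]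
  infer_instance

end FiberSmooth

/-! ### Determinants under rank-one perturbations. -/

section RankOne

variable {R : Type*} [CommRing R] {ι : Type*} [Fintype ι] [DecidableEq ι]

theorem det_add_vecMulVec_of_isUnit {A : Matrix ι ι R} (hA : IsUnit A.det) (u v : ι → R) :
    (A + Matrix.vecMulVec u v).det = A.det + v ⬝ᵥ A.adjugate.mulVec u := by
  have h := Matrix.det_add_replicateCol_mul_replicateRow (ι := Unit) hA u v
  rw [← Matrix.vecMulVec_eq] at h
  rw [h, Matrix.det_unique (n := Unit), Matrix.add_apply, Matrix.one_apply_eq, Matrix.mul_assoc,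
    ← Matrix.replicateCol_mulVec, Matrix.replicateRow_mul_replicateCol_apply, mul_add, mul_one,
    Matrix.inv_def, Matrix.smul_mulVec, dotProduct_smul, smul_eq_mul, ← mul_assoc,
    Ring.mul_inverse_cancel _ hA, one_mul]

/-- The matrix determinant lemma, without an invertibility assumption. -/
theorem det_add_vecMulVec (A : Matrix ι ι R) (u v : ι → R) :
    (A + Matrix.vecMulVec u v).det = A.det + v ⬝ᵥ A.adjugate.mulVec u := by
  -- `G = X + A` has monic determinant, which becomes invertible in a localization containing
  -- `R[X]`. The identity proved there specializes at `X = 0`.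
  set G : Matrix ι ι R[X] := Matrix.charmatrix (-A) with hG
  have hmon : G.det.Monic := Matrix.charpoly_monic (-A)
  have hreg : G.det ∈ nonZeroDivisors R[X] := hmon.mem_nonZeroDivisors
  let S := Localization (nonZeroDivisors R[X])
  let f : R[X] →+* S := algebraMap R[X] S
  have hinj : Function.Injective f := IsLocalization.injective S le_rfl
  have hunit : IsUnit (G.map f).det := by
    have : (G.map f).det = f G.det := (RingHom.map_det f G).symm
    rw [this]
    exact IsLocalization.map_units S ⟨_, hreg⟩
  have h1 : (G + Matrix.vecMulVec (C ∘ u) (C ∘ v)).det =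
      G.det + (C ∘ v) ⬝ᵥ G.adjugate.mulVec (C ∘ u) := by
    apply hinj
    have h2 := det_add_vecMulVec_of_isUnit hunit (f ∘ C ∘ u) (f ∘ C ∘ v)
    have h3 : G.map f + Matrix.vecMulVec (f ∘ C ∘ u) (f ∘ C ∘ v) =
        (G + Matrix.vecMulVec (C ∘ u) (C ∘ v)).map f := by
      ext i j
      simp [Matrix.vecMulVec_apply]
    have h4 : (G.map f).adjugate = G.adjugate.map f := (RingHom.map_adjugate f G).symm
    have h5 : f ∘ G.adjugate.mulVec (C ∘ u) = (G.adjugate.map f).mulVec (f ∘ C ∘ u) :=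
      funext fun i => RingHom.map_mulVec f _ _ i
    rw [h3, h4, ← h5, ← RingHom.map_dotProduct] at h2
    rw [map_add, RingHom.map_det, RingHom.map_det]
    exact h2
  have h5 := congrArg (evalRingHom 0) h1
  have h6 : (evalRingHom (0 : R)).mapMatrix G = A := by
    ext i j
    by_cases h : i = j <;> simp [hG, h]
  have h10 : evalRingHom (0 : R) ∘ G.adjugate.mulVec (C ∘ u) =
      (G.adjugate.map (evalRingHom (0 : R))).mulVec (evalRingHom (0 : R) ∘ C ∘ u) :=
    funext fun i => RingHom.map_mulVec _ _ _ i
  rw [map_add, RingHom.map_det, RingHom.map_det, map_add, h6, RingHom.map_dotProduct,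
    h10] at h5
  have h7 : G.adjugate.map (evalRingHom (0 : R)) = A.adjugate := by
    rw [← h6, ← RingHom.map_adjugate]
    rfl
  have h8 : (evalRingHom (0 : R)).mapMatrix (Matrix.vecMulVec (C ∘ u) (C ∘ v)) =
      Matrix.vecMulVec u v := by
    ext i j
    simp [Matrix.vecMulVec_apply]
  have h9 : ∀ w : ι → R, evalRingHom (0 : R) ∘ C ∘ w = w := fun w => by
    ext i
    simp
  rw [h7, h8, h9, h9] at h5
  exact h5

variable {S : Type*} [CommRing S]

/-- The sum of the principal minors of size two. -/
noncomputable def minorSum₂ (A : Matrix ι ι R) : R :=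
  (1 + (X : R[X]) • A.map C).det.coeff 2

theorem map_minorSum₂ (f : R →+* S) (A : Matrix ι ι R) :
    f (minorSum₂ A) = minorSum₂ (A.map f) := by
  rw [minorSum₂, minorSum₂, ← coeff_map, ← coe_mapRingHom, RingHom.map_det]
  congr 2
  ext i j : 2
  simp [Matrix.one_apply, apply_ite]

/-- Evaluate the polynomial `det (1 + X A)` at `p`, with its three lowest terms split off. Third
order suffices: the coordinates are later divided by at most `p ^ 2`, and the remainder then
vanishes where `p` does. -/
theorem det_one_add_smul_expansion (p : R) (A : Matrix ι ι R) :
    ∃ q, (1 + p • A).det = 1 + p * A.trace + p ^ 2 * minorSum₂ A + p ^ 3 * q := by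
  set D := (1 + (X : R[X]) • A.map C).det with hD
  have h0 : D.coeff 0 = 1 := by
    rw [coeff_zero_eq_eval_zero, hD, ← coe_evalRingHom, RingHom.map_det]
    have : (evalRingHom (0 : R)).mapMatrix (1 + (X : R[X]) • A.map C) = 1 := by
      ext i j
      obtain rfl | hij := eq_or_ne i j <;> simp [*]
    rw [this, Matrix.det_one]
  have h1 : D.coeff 1 = A.trace := Matrix.coeff_det_one_add_X_smul_one A
  have h2 : (1 + p • A).det = D.eval p := by
    rw [hD, ← coe_evalRingHom, RingHom.map_det]
    congr 1
    ext i j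
    rcases eq_or_ne i j with rfl | hij
    · simp
      ring
    · simp [hij]
      ring
  have h3 : D = C 1 + X * (C A.trace + X * (C (minorSum₂ A) + X * D.divX.divX.divX)) := by
    conv_lhs => rw [← X_mul_divX_add D, ← X_mul_divX_add D.divX, ← X_mul_divX_add D.divX.divX]
    rw [coeff_divX, coeff_divX, coeff_divX, h0, h1, minorSum₂]
    ring
  refine ⟨D.divX.divX.divX.eval p, ?_⟩
  rw [h2]
  conv_lhs => rw [h3]
  simp only [eval_add, eval_mul, eval_C, eval_X]
  ring

/-- By the matrix determinant lemma, a rank-one perturbation acts without quadratic correction. This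
is what makes the tangent computation linear in `u`. -/
theorem minorSum₂_add_vecMulVec (A : Matrix ι ι R) (u v : ι → R) :
    minorSum₂ (A + Matrix.vecMulVec u v) =
      minorSum₂ A + (A.trace * (v ⬝ᵥ u) - v ⬝ᵥ A.mulVec u) := by
  set G : Matrix ι ι R[X] := 1 + (X : R[X]) • A.map C with hG
  have h1 : 1 + (X : R[X]) • (A + Matrix.vecMulVec u v).map C =
      G + Matrix.vecMulVec ((X : R[X]) • (C ∘ u)) (C ∘ v) := by
    ext i j : 1
    simp only [hG, Matrix.vecMulVec_apply, Matrix.add_apply, Matrix.smul_apply, Matrix.map_apply,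
      Pi.smul_apply, Function.comp_apply, smul_eq_mul, C_add, C_mul]
    ring
  have h0 : ∀ i j, (G.adjugate i j).coeff 0 = (1 : Matrix ι ι R) i j := by
    intro i j
    have h2 : (evalRingHom (0 : R)).mapMatrix G = 1 := by
      ext i j
      obtain rfl | hij := eq_or_ne i j <;> simp [*]
    have h3 := RingHom.map_adjugate (evalRingHom (0 : R)) G
    rw [h2, Matrix.adjugate_one] at h3
    rw [coeff_zero_eq_eval_zero]
    exact congrFun (congrFun h3 i) j
  -- That is, `adj G = 1 + X (tr A - A) + O(X²)`, read off from `G * adj G = det G`.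
  have h4 : ∀ i j, (G.adjugate i j).coeff 1 = A.trace * (1 : Matrix ι ι R) i j - A i j := by
    intro i j
    have h5 := congrArg (fun M : Matrix ι ι R[X] => (M i j).coeff 1) (Matrix.mul_adjugate G)
    simp only [Matrix.smul_apply, smul_eq_mul] at h5
    have h6 : (G.det * (1 : Matrix ι ι R[X]) i j).coeff 1 = A.trace * (1 : Matrix ι ι R) i j := by
      have := Matrix.coeff_det_one_add_X_smul_one A
      rw [← hG] at this
      by_cases hij : i = j <;> simp [Matrix.one_apply, hij, this]
    have h7 : ((G * G.adjugate) i j).coeff 1 = (G.adjugate i j).coeff 1 + A i j := by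
      rw [hG, Matrix.add_mul, Matrix.one_mul, Matrix.smul_mul, ← hG, Matrix.add_apply, coeff_add,
        Matrix.smul_apply, smul_eq_mul, coeff_X_mul, Matrix.mul_apply, finsetSum_coeff]
      congr 1
      simp only [Matrix.map_apply, coeff_C_mul, h0]
      rw [← Matrix.mul_apply, Matrix.mul_one]
    rw [h6, h7] at h5
    linear_combination h5
  have h8 : ((C ∘ v) ⬝ᵥ G.adjugate.mulVec ((X : R[X]) • (C ∘ u))).coeff 2 =
      A.trace * (v ⬝ᵥ u) - v ⬝ᵥ A.mulVec u := by
    rw [Matrix.mulVec_smul, dotProduct_smul, smul_eq_mul, coeff_X_mul]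
    simp only [dotProduct, Matrix.mulVec, finsetSum_coeff, Function.comp_apply, coeff_C_mul,
      coeff_mul_C, h4, sub_mul, mul_sub, Finset.sum_sub_distrib]
    congr 1
    rw [Finset.mul_sum]
    refine Finset.sum_congr rfl fun i _ => ?_
    rw [Finset.sum_eq_single i]
    · rw [Matrix.one_apply_eq]
      ring
    · intro j _ hj
      rw [Matrix.one_apply_ne hj.symm]
      ring
    · simp
  rw [minorSum₂, h1, det_add_vecMulVec, coeff_add, h8]
  rfl

end RankOne

/-! ### Expansion of the reversed characteristic polynomial around a nilpotent matrix. -/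

section Expansion

variable {R : Type*} [CommRing R] {ι : Type*} [Fintype ι] [DecidableEq ι]

/-- The truncated geometric series `∑_{k < d} t ^ k N ^ k`. -/
noncomputable def geomSeries (d : ℕ) (N : Matrix ι ι R) : Matrix ι ι R[X] :=
  ∑ k ∈ Finset.range d, (X : R[X]) ^ k • (N ^ k).map C

theorem map_geomSeries {S : Type*} [CommRing S] (f : R →+* S) (d : ℕ) (N : Matrix ι ι R) :
    (geomSeries d N).map (mapRingHom f) = geomSeries d (N.map f) := by
  have h : (mapRingHom f).mapMatrix (geomSeries d N) = geomSeries d (N.map f) := by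
    rw [geomSeries, geomSeries, map_sum]
    refine Finset.sum_congr rfl fun k _ => ?_
    have : (N.map f) ^ k = (N ^ k).map f := (map_pow f.mapMatrix N k).symm
    rw [this]
    ext i j : 2
    simp
  exact h

/-- The matrix `-t U B` with `U` the geometric series of `N`. -/
noncomputable def perturbation (d : ℕ) (N B : Matrix ι ι R) : Matrix ι ι R[X] :=
  -((X : R[X]) • (geomSeries d N * B.map C))

theorem map_perturbation {S : Type*} [CommRing S] (f : R →+* S) (d : ℕ) (N B : Matrix ι ι R) :
    (perturbation d N B).map (mapRingHom f) = perturbation d (N.map f) (B.map f) := by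
  rw [perturbation, perturbation, ← map_geomSeries]
  have h : (B.map f).map C = (B.map C).map (mapRingHom f) := by
    ext i j : 2
    simp
  rw [h, ← Matrix.map_mul]
  ext i j : 2
  simp

/-- Factor out `1 - X N`, whose inverse is the geometric series. Its determinant is a unit of
`R[X]`, hence constant over a domain, and it equals 1 at `X = 0`. -/
theorem charpolyRev_add_smul [IsDomain R] (N B : Matrix ι ι R) (p : R) (d : ℕ) (hN : N ^ d = 0) :
    ∃ q : R[X], (N + p • B).charpolyRev =
      1 + C p * (perturbation d N B).trace + C p ^ 2 * minorSum₂ (perturbation d N B) +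
        C p ^ 3 * q := by
  set N' : Matrix ι ι R[X] := (X : R[X]) • N.map C with hN'
  have hN'k : ∀ k, N' ^ k = (X : R[X]) ^ k • (N ^ k).map C := by
    intro k
    rw [hN', _root_.smul_pow, ← Matrix.map_pow]
  have hN'd : N' ^ d = 0 := by
    rw [hN'k, hN]
    simp
  have hU : geomSeries d N = ∑ k ∈ Finset.range d, N' ^ k :=
    Finset.sum_congr rfl fun k _ => (hN'k k).symm
  have hU1 : (1 - N') * geomSeries d N = 1 := by
    rw [hU, mul_neg_geom_sum, hN'd, sub_zero]
  have hdet : (1 - N').det = 1 := by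
    have hu : IsUnit (1 - N').det := by
      refine IsUnit.of_mul_eq_one (geomSeries d N).det ?_
      rw [← Matrix.det_mul, hU1, Matrix.det_one]
    obtain ⟨a, -, ha⟩ := Polynomial.isUnit_iff.mp hu
    have h0 : (1 - N').det.eval 0 = 1 := by
      have := Matrix.eval_charpolyRev (M := N)
      rwa [Matrix.charpolyRev] at this
    rw [← ha, eval_C] at h0
    rw [← ha, h0, C_1]
  have hfac : 1 - (X : R[X]) • (N + p • B).map C = (1 - N') * (1 + C p • perturbation d N B) := by
    have h1 : (N + p • B).map C = N.map C + C p • B.map C := by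
      ext i j : 2
      simp [Matrix.map_apply]
    rw [perturbation, mul_add, mul_one, h1, smul_neg, mul_neg, mul_smul_comm, mul_smul_comm,
      ← mul_assoc, hU1, one_mul, smul_add, ← hN', smul_comm (X : R[X]) (C p)]
    abel
  rw [Matrix.charpolyRev, hfac, Matrix.det_mul, hdet, one_mul]
  exact det_one_add_smul_expansion (C p) (perturbation d N B)

/-- Truncating the series at `d` loses nothing because `N ^ d = 0`, so the formula holds for every
`i`. For `i ≥ d` the term of order `p` disappears, which allows division by `p ^ 2`. -/
theorem coeff_trace_perturbation (d : ℕ) (N B : Matrix ι ι R) (hN : N ^ d = 0) (i : ℕ) :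
    (perturbation d N B).trace.coeff (i + 1) = -(N ^ i * B).trace := by
  rw [perturbation, Matrix.trace_neg, Matrix.trace_smul, coeff_neg, smul_eq_mul, coeff_X_mul,
    geomSeries, Finset.sum_mul, Matrix.trace_sum, finsetSum_coeff]
  congr 1
  have h : ∀ k, ((X : R[X]) ^ k • (N ^ k).map C * B.map C).trace.coeff i =
      if i = k then (N ^ k * B).trace else 0 := by
    intro k
    rw [smul_mul_assoc, ← Matrix.map_mul, Matrix.trace_smul, smul_eq_mul, mul_comm]
    have : ((N ^ k * B).map C).trace = C (N ^ k * B).trace := by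
      rw [Matrix.trace, Matrix.trace, map_sum]
      rfl
    rw [this, coeff_C_mul_X_pow]
  rw [Finset.sum_congr rfl fun k _ => h k, Finset.sum_ite_eq]
  split_ifs with hi
  · rfl
  · rw [pow_eq_zero_of_le (by simpa using hi) hN, zero_mul, Matrix.trace_zero]

theorem perturbation_add_vecMulVec (d : ℕ) (N B : Matrix ι ι R) (z w : ι → R) :
    perturbation d N (B + Matrix.vecMulVec z w) = perturbation d N B +
      Matrix.vecMulVec (-((X : R[X]) • (geomSeries d N).mulVec (C ∘ z))) (C ∘ w) := by
  have h : (B + Matrix.vecMulVec z w).map C =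
      B.map C + Matrix.vecMulVec (C ∘ z) (C ∘ w) := by
    ext i j : 2
    simp [Matrix.vecMulVec_apply]
  rw [perturbation, perturbation, h, Matrix.mul_add, Matrix.mul_vecMulVec, smul_add, neg_add,
    Matrix.neg_vecMulVec, Matrix.smul_vecMulVec]

end Expansion

/-! ### The coordinates of the morphism modulo the uniformizer. -/

section SpecialFiber

variable {R : Type*} [CommRing R] {l₁ l₂ : ℕ}

variable (R l₁ l₂) in
/-- The block diagonal matrix of two nilpotent Jordan blocks. -/
def jordanPair : Matrix (Fin l₁ ⊕ Fin l₂) (Fin l₁ ⊕ Fin l₂) R :=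
  Matrix.fromBlocks (jordanBlock R l₁) 0 0 (jordanBlock R l₂)

/-- The part of `congruenceMatrix p X` which does not involve `p`. -/
def nilpotentPart (X : Matrix (Idx l₁ l₂) (Idx l₁ l₂) R) : Matrix (Idx l₁ l₂) (Idx l₁ l₂) R :=
  Matrix.fromBlocks (jordanPair R l₁ l₂) X.toBlocks₁₂ 0 0

/-- The coefficient of `p` in `congruenceMatrix p X`. -/
def linearPart (X : Matrix (Idx l₁ l₂) (Idx l₁ l₂) R) : Matrix (Idx l₁ l₂) (Idx l₁ l₂) R :=
  Matrix.fromBlocks X.toBlocks₁₁ 0 X.toBlocks₂₁ X.toBlocks₂₂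

/-- The matrix obtained from `congruenceMatrix p X` by dividing the last two rows by `p` and
putting `p = 0` in the other ones. -/
def dividedMatrix (X : Matrix (Idx l₁ l₂) (Idx l₁ l₂) R) : Matrix (Idx l₁ l₂) (Idx l₁ l₂) R :=
  Matrix.fromBlocks (jordanPair R l₁ l₂) X.toBlocks₁₂ X.toBlocks₂₁ X.toBlocks₂₂

theorem congruenceMatrix_eq_add (p : R) (X : Matrix (Idx l₁ l₂) (Idx l₁ l₂) R) :
    congruenceMatrix p X = nilpotentPart X + p • linearPart X :=
  congruenceMatrix_eq p X

theorem nilpotentPart_pow_eq_zero (h : l₁ ≤ l₂) (X : Matrix (Idx l₁ l₂) (Idx l₁ l₂) R) :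
    nilpotentPart X ^ (l₂ + 1) = 0 :=
  nilpotentPart_pow h _

section Map

variable {S : Type*} [CommRing S] (f : R →+* S) (X : Matrix (Idx l₁ l₂) (Idx l₁ l₂) R)

theorem map_jordanPair : (jordanPair R l₁ l₂).map f = jordanPair S l₁ l₂ := by
  ext (i | i) (j | j) <;> simp [jordanPair, jordanBlock]

theorem map_nilpotentPart : (nilpotentPart X).map f = nilpotentPart (X.map f) := by
  rw [nilpotentPart, nilpotentPart, Matrix.fromBlocks_map, map_jordanPair, Matrix.map_zero _ f.map_zero,
    Matrix.map_zero _ f.map_zero]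
  rfl

theorem map_linearPart : (linearPart X).map f = linearPart (X.map f) := by
  rw [linearPart, linearPart, Matrix.fromBlocks_map, Matrix.map_zero _ f.map_zero]
  rfl

end Map

/-- The matrix of coordinates of a point of `End(L)_{M,l₁}`. -/
noncomputable def coordMatrix {o : Type*} [CommRing o] [Algebra o R] (f : EndRing o l₁ l₂ →ₐ[o] R) :
    Matrix (Idx l₁ l₂) (Idx l₁ l₂) R :=
  Matrix.of fun i j => f (MvPolynomial.X (i, j))

variable {o : Type*} [CommRing o] {π : o} [Algebra o R]

theorem eq_add_of_pow_mul_eq {A : Type*} [CommRing A] [IsDomain A] {a x y e : A} (k : ℕ)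
    (ha : a ≠ 0) (h : a ^ k * x = a ^ k * y + a ^ (k + 1) * e) : x = y + a * e :=
  mul_left_cancel₀ (pow_ne_zero k ha) (by rw [h]; ring)

theorem eq_add_of_mul_eq {A : Type*} [CommRing A] [IsDomain A] {a x y e q : A}
    (ha : a ≠ 0) (h : a * x = a * y + a ^ 2 * e + a ^ 3 * q) : x = y + a * (e + a * q) :=
  mul_left_cancel₀ ha (by rw [h]; ring)

theorem map_mvPolynomialX (f : EndRing o l₁ l₂ →ₐ[o] R) :
    (Matrix.mvPolynomialX (Idx l₁ l₂) (Idx l₁ l₂) o).map (f : EndRing o l₁ l₂ →+* R) =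
      coordMatrix f := by
  ext i j
  simp [coordMatrix]

theorem algebraMap_endRing_ne_zero [IsDomain o] (hπ : π ≠ 0) : algebraMap o (EndRing o l₁ l₂) π ≠ 0 := by
  rw [MvPolynomial.algebraMap_eq]
  simpa using hπ

variable [IsDomain o]

/-- Reversal moves `c_{i+1}` to degree `i + 1`, where the expansion in `π` applies. -/
theorem phiHom_eq_charpolyRev (h : l₁ ≤ l₂) (i : Fin (l₁ + l₂ + 2)) :
    algebraMap o (EndRing o l₁ l₂) π ^ expo l₂ i * phiHom π h (MvPolynomial.X i) =
      (universalMatrix π l₁ l₂).charpolyRev.coeff (i + 1) := by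
  have hspec := affPoint_spec π (coeffVec_universalMatrix_mem π (o := o) h) i
  rw [phiHom, hspec, coeffVec, ← Matrix.reverse_charpoly, coeff_reverse,
    Matrix.charpoly_natDegree_eq_dim]
  have hcard : Fintype.card (Idx l₁ l₂) = l₁ + l₂ + 2 := by simp [Idx]
  have hi := i.2
  rw [hcard, revAt_le (by omega)]
  congr 1
  omega

/-- The expansion is made for the universal matrix: its coordinate ring is a domain, so powers of
`π` can be cancelled there before reducing to `π = 0`. -/
theorem phiHom_coeff_expansion (h : l₁ ≤ l₂) (i : ℕ) :
    ∃ q : EndRing o l₁ l₂,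
      (universalMatrix π l₁ l₂).charpolyRev.coeff (i + 1) =
        algebraMap o _ π *
          -(nilpotentPart (Matrix.mvPolynomialX (Idx l₁ l₂) (Idx l₁ l₂) o) ^ i *
            linearPart (Matrix.mvPolynomialX (Idx l₁ l₂) (Idx l₁ l₂) o)).trace +
        algebraMap o _ π ^ 2 * (minorSum₂ (perturbation (l₂ + 1)
          (nilpotentPart (Matrix.mvPolynomialX (Idx l₁ l₂) (Idx l₁ l₂) o))
          (linearPart (Matrix.mvPolynomialX (Idx l₁ l₂) (Idx l₁ l₂) o)))).coeff (i + 1) +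
        algebraMap o _ π ^ 3 * q := by
  obtain ⟨q, hq⟩ := charpolyRev_add_smul
    (nilpotentPart (Matrix.mvPolynomialX (Idx l₁ l₂) (Idx l₁ l₂) o))
    (linearPart (Matrix.mvPolynomialX (Idx l₁ l₂) (Idx l₁ l₂) o))
    (algebraMap o (EndRing o l₁ l₂) π) (l₂ + 1) (nilpotentPart_pow_eq_zero h _)
  refine ⟨q.coeff (i + 1), ?_⟩
  rw [universalMatrix, congruenceMatrix_eq_add, hq, ← C_pow, ← C_pow, coeff_add, coeff_add,
    coeff_add, coeff_C_mul, coeff_C_mul, coeff_C_mul,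
    coeff_trace_perturbation _ _ _ (nilpotentPart_pow_eq_zero h _), coeff_one,
    if_neg (Nat.succ_ne_zero i), zero_add]

/-- On the special fiber, the first coordinates of `φ_{l₁}` are traces. -/
theorem phiHom_special_low (hπ : π ≠ 0) (hπR : algebraMap o R π = 0) (h : l₁ ≤ l₂)
    (f : EndRing o l₁ l₂ →ₐ[o] R) (i : Fin (l₁ + l₂ + 2)) (hi : (i : ℕ) ≤ l₂) :
    f (phiHom π h (MvPolynomial.X i)) =
      -(nilpotentPart (coordMatrix f) ^ (i : ℕ) * linearPart (coordMatrix f)).trace := by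
  obtain ⟨q, hq⟩ := phiHom_coeff_expansion (π := π) h i
  rw [← phiHom_eq_charpolyRev h, expo, if_pos hi, pow_one] at hq
  have h1 := eq_add_of_mul_eq (algebraMap_endRing_ne_zero hπ) hq
  rw [h1, map_add, map_mul, AlgHom.commutes, hπR, zero_mul, add_zero, map_neg,
    ← map_mvPolynomialX, ← map_nilpotentPart, ← map_linearPart]
  congr 1
  set N := nilpotentPart (Matrix.mvPolynomialX (Idx l₁ l₂) (Idx l₁ l₂) o)
  have h2 : (N.map (f : EndRing o l₁ l₂ →+* R)) ^ (i : ℕ) = (N ^ (i : ℕ)).map f :=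
    (map_pow (f : EndRing o l₁ l₂ →+* R).mapMatrix N i).symm
  rw [h2]
  change f _ = (((N ^ (i : ℕ)).map (f : EndRing o l₁ l₂ →+* R)) * _).trace
  rw [← Matrix.map_mul, Matrix.trace, Matrix.trace, map_sum]
  rfl

/-- On the special fiber, the last coordinates of `φ_{l₁}` are sums of minors of size two. -/
theorem phiHom_special_high (hπ : π ≠ 0) (hπR : algebraMap o R π = 0) (h : l₁ ≤ l₂)
    (f : EndRing o l₁ l₂ →ₐ[o] R) (i : Fin (l₁ + l₂ + 2)) (hi : l₂ < (i : ℕ)) :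
    f (phiHom π h (MvPolynomial.X i)) =
      (minorSum₂ (perturbation (l₂ + 1) (nilpotentPart (coordMatrix f))
        (linearPart (coordMatrix f)))).coeff (i + 1) := by
  obtain ⟨q, hq⟩ := phiHom_coeff_expansion (π := π) h i
  rw [← phiHom_eq_charpolyRev h, expo, if_neg (by omega),
    pow_eq_zero_of_le (show l₂ + 1 ≤ (i : ℕ) from hi) (nilpotentPart_pow_eq_zero h _), zero_mul,
    Matrix.trace_zero, neg_zero, mul_zero, zero_add] at hq
  have h1 := eq_add_of_pow_mul_eq 2 (algebraMap_endRing_ne_zero hπ) hq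
  rw [h1, map_add, map_mul, AlgHom.commutes, hπR, zero_mul, add_zero,
    ← map_mvPolynomialX, ← map_nilpotentPart, ← map_linearPart, ← map_perturbation,
    ← map_minorSum₂, coe_mapRingHom, coeff_map]
  rfl

/-- On the special fiber, the last coordinate of `φ_{l₁}` is a determinant. -/
theorem phiHom_special_last (hπ : π ≠ 0) (hπR : algebraMap o R π = 0) (h : l₁ ≤ l₂) (hl₁ : 0 < l₁)
    (f : EndRing o l₁ l₂ →ₐ[o] R) :
    f (phiHom π h (MvPolynomial.X (Fin.last (l₁ + l₂ + 1)))) =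
      (-1) ^ (l₁ + l₂) * (dividedMatrix (coordMatrix f)).det := by
  set p := algebraMap o (EndRing o l₁ l₂) π with hp
  set 𝒳 := Matrix.mvPolynomialX (Idx l₁ l₂) (Idx l₁ l₂) o with h𝒳
  -- `K` is the universal matrix with its last two rows divided by `π`, which accounts for the
  -- factor `π ^ 2` of the determinant.
  set K := Matrix.fromBlocks (jordanPair (EndRing o l₁ l₂) l₁ l₂ + p • 𝒳.toBlocks₁₁)
    𝒳.toBlocks₁₂ 𝒳.toBlocks₂₁ 𝒳.toBlocks₂₂ with hK
  have hspec := affPoint_spec π (coeffVec_universalMatrix_mem π (o := o) h)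
    (Fin.last (l₁ + l₂ + 1))
  have hcard : Fintype.card (Idx l₁ l₂) = l₁ + l₂ + 2 := by simp [Idx]
  have hfac : universalMatrix π l₁ l₂ =
      Matrix.fromBlocks (1 : Matrix (Fin l₁ ⊕ Fin l₂) (Fin l₁ ⊕ Fin l₂) _) 0 0
        (p • (1 : Matrix (Fin 2) (Fin 2) _)) * K := by
    rw [hK, Matrix.fromBlocks_multiply]
    simp [universalMatrix, congruenceMatrix, jordanPair, hp, h𝒳]
  have hdet : (universalMatrix π l₁ l₂).det = p ^ 2 * K.det := by
    rw [hfac, Matrix.det_mul, Matrix.det_fromBlocks_zero₂₁, Matrix.det_one, one_mul,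
      Matrix.det_smul, Matrix.det_one, Fintype.card_fin, mul_one]
  have hcoef : (universalMatrix π l₁ l₂).charpoly.coeff 0 = (-1) ^ (l₁ + l₂) * (p ^ 2 * K.det) := by
    have h1 := Matrix.det_eq_sign_charpoly_coeff (universalMatrix π l₁ l₂)
    rw [hcard, hdet] at h1
    rw [h1, ← mul_assoc, ← pow_add, Even.neg_one_pow ⟨l₁ + l₂ + 1, by ring⟩, one_mul]
  have hexp : expo l₂ (Fin.last (l₁ + l₂ + 1)) = 2 := by
    rw [expo, if_neg]
    simp only [Fin.val_last]
    omega
  rw [hexp, coeffVec, Fin.val_last, show l₁ + l₂ + 2 - 1 - (l₁ + l₂ + 1) = 0 by omega, hcoef,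
    mul_left_comm] at hspec
  have h1 : phiHom π h (MvPolynomial.X (Fin.last (l₁ + l₂ + 1))) = (-1) ^ (l₁ + l₂) * K.det :=
    mul_left_cancel₀ (pow_ne_zero 2 (algebraMap_endRing_ne_zero hπ)) hspec
  rw [h1, map_mul, map_pow, map_neg, map_one]
  congr 1
  have h2 : f K.det = (K.map (f : EndRing o l₁ l₂ →+* R)).det :=
    RingHom.map_det (f : EndRing o l₁ l₂ →+* R) K
  rw [h2, ← map_mvPolynomialX]
  congr 1
  have hfp : f p = 0 := (AlgHom.commutes f π).trans hπR
  rw [hK, Matrix.fromBlocks_map, dividedMatrix]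
  congr 1
  rw [← map_jordanPair (f : EndRing o l₁ l₂ →+* R)]
  ext i j
  simp [hfp]

end SpecialFiber

/-! ### Linear algebra of two nilpotent Jordan blocks. -/

section JordanPair

variable (R : Type*) [CommRing R] (l₁ l₂ : ℕ)

theorem jordanBlock_pow_apply (l k : ℕ) (i j : Fin l) :
    (jordanBlock R l ^ k) i j = if (i : ℕ) + k = (j : ℕ) then 1 else 0 := by
  induction k generalizing j with
  | zero => simp [Matrix.one_apply, Fin.ext_iff]
  | succ k ih =>
    have hJ : ∀ a b : Fin l, jordanBlock R l a b = if (a : ℕ) + 1 = b then 1 else 0 :=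
      fun a b => rfl
    rw [pow_succ, Matrix.mul_apply]
    simp only [ih, hJ, ite_mul, one_mul, zero_mul]
    split_ifs with h
    · rw [Finset.sum_eq_single ⟨i + k, by omega⟩]
      · rw [if_pos rfl, if_pos (by simp; omega)]
      · intro b _ hb
        rw [if_neg]
        intro hc
        exact hb (Fin.ext hc.symm)
      · simp
    · refine Finset.sum_eq_zero fun b _ => ?_
      split_ifs
      · omega
      · rfl
      · rfl

theorem jordanPair_pow (k : ℕ) : jordanPair R l₁ l₂ ^ k =
    Matrix.fromBlocks (jordanBlock R l₁ ^ k) 0 0 (jordanBlock R l₂ ^ k) := by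
  rw [jordanPair, Matrix.fromBlocks_diagonal_pow]

/-- The columns are the first basis vectors of the two Jordan blocks. -/
def headMatrix : Matrix (Fin l₁ ⊕ Fin l₂) (Fin 2) R :=
  Matrix.of fun i b => Sum.elim (fun a : Fin l₁ => if (a : ℕ) = 0 ∧ b = 0 then 1 else 0)
    (fun a : Fin l₂ => if (a : ℕ) = 0 ∧ b = 1 then 1 else 0) i

/-- The columns are the last basis vectors of the two Jordan blocks. -/
def tailMatrix : Matrix (Fin l₁ ⊕ Fin l₂) (Fin 2) R :=
  Matrix.of fun i b => Sum.elim (fun a : Fin l₁ => if (a : ℕ) + 1 = l₁ ∧ b = 0 then 1 else 0)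
    (fun a : Fin l₂ => if (a : ℕ) + 1 = l₂ ∧ b = 1 then 1 else 0) i

/-- The relation between head and tail vectors given by the maximal power of a pair of Jordan
blocks. -/
def headTail : Matrix (Fin 2) (Fin 2) R :=
  Matrix.diagonal fun b => if b = 0 ∧ l₁ < l₂ then 0 else 1

variable {l₁ l₂}

theorem jordanPair_mul_headMatrix : jordanPair R l₁ l₂ * headMatrix R l₁ l₂ = 0 := by
  ext (i | i) b <;>
    simp only [jordanPair, headMatrix, jordanBlock, Matrix.mul_apply, Fintype.sum_sum_type,
      Matrix.fromBlocks_apply₁₁, Matrix.fromBlocks_apply₁₂, Matrix.fromBlocks_apply₂₁,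
      Matrix.fromBlocks_apply₂₂, Matrix.of_apply, Matrix.zero_apply, Sum.elim_inl, Sum.elim_inr,
      zero_mul, Finset.sum_const_zero, add_zero, zero_add] <;>
    refine Finset.sum_eq_zero fun j _ => ?_ <;> split_ifs <;> first | omega | simp

theorem sum_ite_val_eq {l : ℕ} (c : ℕ) (f : Fin l → R) :
    ∑ j : Fin l, (if (j : ℕ) = c then f j else 0) = if h : c < l then f ⟨c, h⟩ else 0 := by
  split_ifs with h
  · rw [Finset.sum_eq_single ⟨c, h⟩]
    · simp
    · intro b _ hb
      rw [if_neg fun hc => hb (Fin.ext hc)]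
    · simp
  · refine Finset.sum_eq_zero fun b _ => if_neg ?_
    have := b.2
    omega

theorem headMatrix_transpose_mul (h₁ : 0 < l₁) (h₂ : 0 < l₂) :
    (headMatrix R l₁ l₂).transpose * headMatrix R l₁ l₂ = 1 := by
  ext b c
  fin_cases b <;> fin_cases c <;>
    simp [headMatrix, Matrix.mul_apply, Fintype.sum_sum_type, sum_ite_val_eq, h₁, h₂]

theorem tailMatrix_transpose_mul (h₁ : 0 < l₁) (h₂ : 0 < l₂) :
    (tailMatrix R l₁ l₂).transpose * tailMatrix R l₁ l₂ = 1 := by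
  have h : ∀ (l : ℕ) (j : Fin l), (j : ℕ) + 1 = l ↔ (j : ℕ) = l - 1 := fun l j => by omega
  ext b c
  fin_cases b <;> fin_cases c <;>
    simp [tailMatrix, Matrix.mul_apply, Fintype.sum_sum_type, h, sum_ite_val_eq, h₁, h₂]

theorem tailMatrix_transpose_mul_jordanPair :
    (tailMatrix R l₁ l₂).transpose * jordanPair R l₁ l₂ = 0 := by
  ext b (i | i) <;>
    simp only [jordanPair, tailMatrix, jordanBlock, Matrix.mul_apply, Fintype.sum_sum_type,
      Matrix.fromBlocks_apply₁₁, Matrix.fromBlocks_apply₁₂, Matrix.fromBlocks_apply₂₁,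
      Matrix.fromBlocks_apply₂₂, Matrix.of_apply, Matrix.zero_apply, Sum.elim_inl, Sum.elim_inr,
      mul_zero, Finset.sum_const_zero, add_zero, zero_add, Matrix.transpose_apply] <;>
    refine Finset.sum_eq_zero fun j _ => ?_ <;> split_ifs <;> first | omega | simp

theorem jordanPair_mul_transpose :
    jordanPair R l₁ l₂ * (jordanPair R l₁ l₂).transpose =
      1 - tailMatrix R l₁ l₂ * (tailMatrix R l₁ l₂).transpose := by
  have h : ∀ (l : ℕ) (j i : Fin l), (i : ℕ) + 1 = j ↔ (j : ℕ) = i + 1 := fun l j i => eq_comm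
  ext (i | i) (j | j) <;>
    simp [jordanPair, tailMatrix, jordanBlock, Matrix.mul_apply, Fintype.sum_sum_type,
      Matrix.one_apply, h, sum_ite_val_eq, Fin.ext_iff (n := l₁), Fin.ext_iff (n := l₂), ite_and] <;>
    split_ifs <;> first | omega | simp

/-- The transpose inverts the Jordan pair away from the heads, which span its kernel. -/
theorem jordanPair_transpose_mul :
    (jordanPair R l₁ l₂).transpose * jordanPair R l₁ l₂ =
      1 - headMatrix R l₁ l₂ * (headMatrix R l₁ l₂).transpose := by
  have h : ∀ (l : ℕ) (i : Fin l) (f : Fin l → R),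
      ∑ j : Fin l, (if (j : ℕ) + 1 = i then f j else 0) =
        if h : 0 < (i : ℕ) then f ⟨i - 1, by omega⟩ else 0 := by
    intro l i f
    have h1 : ∀ j : Fin l, (if (j : ℕ) + 1 = i then f j else 0) =
        if (j : ℕ) = i - 1 then (if 0 < (i : ℕ) then f j else 0) else 0 := by
      intro j
      split_ifs <;> first | omega | rfl
    rw [Finset.sum_congr rfl fun j _ => h1 j, sum_ite_val_eq]
    split_ifs <;> first | omega | rfl
  ext (i | i) (j | j) <;>
    simp [jordanPair, headMatrix, jordanBlock, Matrix.mul_apply, Fintype.sum_sum_type,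
      Matrix.one_apply, h, Fin.ext_iff (n := l₁), Fin.ext_iff (n := l₂), ite_and] <;>
    split_ifs <;> first | omega | simp

/-- This power carries the tail of a block of length `l₂` to its head and kills a strictly shorter
block; `headTail` records which blocks survive. -/
theorem jordanPair_pow_pred (hl : l₁ ≤ l₂) (h₁ : 0 < l₁) : jordanPair R l₁ l₂ ^ (l₂ - 1) =
    headMatrix R l₁ l₂ * headTail R l₁ l₂ * (tailMatrix R l₁ l₂).transpose := by
  rw [jordanPair_pow]
  ext (i | i) (j | j) <;>
    simp [jordanBlock_pow_apply, headMatrix, tailMatrix, headTail, Matrix.mul_apply,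
      ite_and, Matrix.diagonal_apply] <;>
    split_ifs <;> first | omega | simp

/-- The matrix permutes the basis in two cycles, of lengths `l₁ + 1` and `l₂ + 1`. -/
theorem det_cycle (h₁ : 0 < l₁) (h₂ : 0 < l₂) :
    (Matrix.fromBlocks (jordanPair R l₁ l₂).transpose (headMatrix R l₁ l₂)
    (tailMatrix R l₁ l₂).transpose 0).det = (-1) ^ (l₁ + l₂) := by
  -- One of the two last indices is appended to each Jordan block, closing it into a cycle.
  let e : Idx l₁ l₂ ≃ Fin (l₁ + 1) ⊕ Fin (l₂ + 1) :=
    (((Equiv.refl _).sumCongr (finSumFinEquiv (m := 1) (n := 1)).symm).trans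
      (Equiv.sumSumSumComm _ _ _ _)).trans (finSumFinEquiv.sumCongr finSumFinEquiv)
  obtain ⟨T, hT⟩ : ∃ T : ∀ l : ℕ, Matrix (Fin (l + 1)) (Fin (l + 1)) R,
      ∀ l, T l = ((finRotate (l + 1)).permMatrix R).transpose := ⟨_, fun _ => rfl⟩
  have hperm : ∀ (l : ℕ) (i j : Fin (l + 1)), T l j i =
      if (if (i : ℕ) = l then 0 else (i : ℕ) + 1) = (j : ℕ) then 1 else 0 := by
    intro l i j
    have h1 : ((finRotate (l + 1) i : Fin (l + 1)) : ℕ) =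
        if (i : ℕ) = l then 0 else (i : ℕ) + 1 := by
      rw [coe_finRotate]
      simp only [Fin.ext_iff, Fin.val_last]
    rw [hT, Matrix.transpose_apply, Equiv.Perm.permMatrix, PEquiv.toMatrix_apply, ← h1,
      Equiv.toPEquiv_apply]
    simp only [Option.mem_some_iff, Fin.ext_iff]
  have h : Matrix.fromBlocks (jordanPair R l₁ l₂).transpose (headMatrix R l₁ l₂)
      (tailMatrix R l₁ l₂).transpose 0 =
      (Matrix.fromBlocks (T l₁) 0 0 (T l₂)).submatrix e e := by
    have e₁ : ∀ a : Fin l₁, e (Sum.inl (Sum.inl a)) = Sum.inl a.castSucc := fun a => rfl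
    have e₂ : ∀ a : Fin l₂, e (Sum.inl (Sum.inr a)) = Sum.inr a.castSucc := fun a => rfl
    have e₃ : e (Sum.inr 0) = Sum.inl (Fin.last l₁) := rfl
    have e₄ : e (Sum.inr 1) = Sum.inr (Fin.last l₂) := rfl
    ext ((i | i) | i) ((j | j) | j) <;> (try fin_cases i) <;> (try fin_cases j) <;>
      simp [e₁, e₂, e₃, e₄, jordanPair, jordanBlock, headMatrix, tailMatrix,
        hperm] <;>
      (try split_ifs) <;> first | omega | simp
  rw [h, Matrix.det_submatrix_equiv_self, Matrix.det_fromBlocks_zero₂₁, hT, hT, Matrix.det_transpose,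
    Matrix.det_transpose, Matrix.det_permutation, Matrix.det_permutation, sign_finRotate,
    sign_finRotate]
  simp [pow_add]

end JordanPair

/-! ### The injectivity argument on the special fiber. -/

section Core

variable {R : Type*} [CommRing R] {l₁ l₂ : ℕ}

/-- The rows of `X₁₂` at the ends of the two Jordan blocks. -/
def tailRows (X : Matrix (Idx l₁ l₂) (Idx l₁ l₂) R) : Matrix (Fin 2) (Fin 2) R :=
  (tailMatrix R l₁ l₂).transpose * X.toBlocks₁₂

/-- The columns of `X₂₁` at the heads of the two Jordan blocks. -/
def headCols (X : Matrix (Idx l₁ l₂) (Idx l₁ l₂) R) : Matrix (Fin 2) (Fin 2) R :=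
  X.toBlocks₂₁ * headMatrix R l₁ l₂

/-- Multiplication by the cycle matrix of `det_cycle` makes the divided matrix block triangular,
since the Jordan pair kills the heads. One diagonal block is `headCols X`; the other is `1 + (X₁₂ -
T) Tᵀ` with `T` the tail matrix, and its determinant is `det (Tᵀ X₁₂)` because `Tᵀ T = 1`. -/
theorem det_dividedMatrix (hl : l₁ ≤ l₂) (h₁ : 0 < l₁) (X : Matrix (Idx l₁ l₂) (Idx l₁ l₂) R) :
    (-1) ^ (l₁ + l₂) * (dividedMatrix X).det = (tailRows X * headCols X).det := by
  have h := congrArg Matrix.det (Matrix.fromBlocks_multiply (jordanPair R l₁ l₂) X.toBlocks₁₂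
    X.toBlocks₂₁ X.toBlocks₂₂ (jordanPair R l₁ l₂).transpose (headMatrix R l₁ l₂)
    (tailMatrix R l₁ l₂).transpose 0)
  have h2 : jordanPair R l₁ l₂ * (jordanPair R l₁ l₂).transpose +
      X.toBlocks₁₂ * (tailMatrix R l₁ l₂).transpose =
      1 + (X.toBlocks₁₂ - tailMatrix R l₁ l₂) * (tailMatrix R l₁ l₂).transpose := by
    rw [jordanPair_mul_transpose, Matrix.sub_mul]
    abel
  rw [Matrix.det_mul, det_cycle R h₁ (h₁.trans_le hl), jordanPair_mul_headMatrix, Matrix.mul_zero,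
    Matrix.mul_zero, add_zero, add_zero, Matrix.det_fromBlocks_zero₁₂, h2,
    Matrix.det_one_add_mul_comm, Matrix.mul_sub, tailMatrix_transpose_mul R h₁ (h₁.trans_le hl),
    add_sub_cancel] at h
  rw [Matrix.det_mul, mul_comm, tailRows, headCols]
  exact h

theorem nilpotentPart_pow_succ (X : Matrix (Idx l₁ l₂) (Idx l₁ l₂) R) (k : ℕ) :
    nilpotentPart X ^ (k + 1) = Matrix.fromBlocks (jordanPair R l₁ l₂ ^ (k + 1))
      (jordanPair R l₁ l₂ ^ k * X.toBlocks₁₂) 0 0 := by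
  induction k with
  | zero => simp [nilpotentPart]
  | succ k ih =>
    rw [pow_succ, ih, nilpotentPart, Matrix.fromBlocks_multiply]
    simp [pow_succ]

/-- The top power sees `X₁₂` only through its tail rows and has image in the span of the heads.
Hence the 2 × 2 matrix `tailRows X * headCols X` governs the leading terms. -/
theorem nilpotentPart_pow_top (hl : l₁ ≤ l₂) (h₁ : 0 < l₁)
    (X : Matrix (Idx l₁ l₂) (Idx l₁ l₂) R) :
    nilpotentPart X ^ l₂ = Matrix.fromBlocks 0
      (headMatrix R l₁ l₂ * headTail R l₁ l₂ * tailRows X) 0 0 := by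
  have h := jordanPair_pow_pred R hl h₁
  obtain ⟨c, hc⟩ : ∃ c, c + 1 = l₂ := ⟨l₂ - 1, by omega⟩
  rw [← hc, Nat.add_sub_cancel, hc] at h
  have h0 : jordanPair R l₁ l₂ ^ (c + 1) = 0 := by
    rw [pow_succ', h, ← Matrix.mul_assoc, ← Matrix.mul_assoc, jordanPair_mul_headMatrix,
      Matrix.zero_mul, Matrix.zero_mul]
  have h2 : nilpotentPart X ^ l₂ = nilpotentPart X ^ (c + 1) := by congr 1; exact hc.symm
  rw [h2, nilpotentPart_pow_succ, h, h0, tailRows, Matrix.mul_assoc]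

theorem trace_fromBlocks {m n : Type*} [Fintype m] [Fintype n] (A : Matrix m m R)
    (B : Matrix m n R) (C : Matrix n m R) (D : Matrix n n R) :
    (Matrix.fromBlocks A B C D).trace = A.trace + D.trace := by
  simp [Matrix.trace, Fintype.sum_sum_type]

theorem trace_nilpotentPart_pow_top (hl : l₁ ≤ l₂) (h₁ : 0 < l₁)
    (X : Matrix (Idx l₁ l₂) (Idx l₁ l₂) R) :
    (nilpotentPart X ^ l₂ * linearPart X).trace =
      (headTail R l₁ l₂ * (tailRows X * headCols X)).trace := by
  rw [nilpotentPart_pow_top hl h₁, linearPart, Matrix.fromBlocks_multiply, trace_fromBlocks,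
    headCols]
  simp only [Matrix.zero_mul, zero_add, add_zero, Matrix.trace_zero]
  rw [Matrix.mul_assoc, Matrix.mul_assoc, Matrix.trace_mul_comm, Matrix.mul_assoc, Matrix.mul_assoc]

/-- The covector which is the combination with coefficients `w` of the coordinates at the heads of
the Jordan blocks. -/
def headVec (l₁ l₂ : ℕ) (w : Fin 2 → R) : Idx l₁ l₂ → R :=
  Sum.elim ((headMatrix R l₁ l₂).mulVec w) 0

variable {k : Type*} [Field k]

/-- Pairing the equation with the tails removes the Jordan part and leaves `tailRows X` applied to
the last two entries of `v`, so these vanish. What remains lies in the kernel of the Jordan pair. -/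
theorem eq_headVec_of_mulVec_eq_zero {X : Matrix (Idx l₁ l₂) (Idx l₁ l₂) k}
    (hP : (tailRows X).det ≠ 0) {v : Idx l₁ l₂ → k} (hv : (nilpotentPart X).mulVec v = 0) :
    v = headVec l₁ l₂ ((headMatrix k l₁ l₂).transpose.mulVec (v ∘ Sum.inl)) := by
  rw [nilpotentPart, Matrix.fromBlocks_mulVec] at hv
  have h1 : (jordanPair k l₁ l₂).mulVec (v ∘ Sum.inl) +
      X.toBlocks₁₂.mulVec (v ∘ Sum.inr) = 0 :=
    funext fun i => congrFun hv (Sum.inl i)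
  have h2 : v ∘ Sum.inr = 0 := by
    have h3 := congrArg (tailMatrix k l₁ l₂).transpose.mulVec h1
    rw [Matrix.mulVec_add, Matrix.mulVec_mulVec, Matrix.mulVec_mulVec,
      tailMatrix_transpose_mul_jordanPair, Matrix.zero_mulVec, zero_add, Matrix.mulVec_zero] at h3
    exact Matrix.eq_zero_of_mulVec_eq_zero hP h3
  rw [h2, Matrix.mulVec_zero, add_zero] at h1
  have h4 := congrArg (jordanPair k l₁ l₂).transpose.mulVec h1
  rw [Matrix.mulVec_mulVec, jordanPair_transpose_mul, Matrix.sub_mulVec, Matrix.one_mulVec,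
    Matrix.mulVec_zero, sub_eq_zero] at h4
  funext i
  rcases i with i | i
  · rw [headVec, Sum.elim_inl, Matrix.mulVec_mulVec, ← h4]
    rfl
  · exact congrFun h2 i

theorem headVec_dotProduct_headVec (h₁ : 0 < l₁) (h₂ : 0 < l₂) (w u : Fin 2 → k) :
    headVec l₁ l₂ w ⬝ᵥ headVec l₁ l₂ u = w ⬝ᵥ u := by
  rw [headVec, headVec, sumElim_dotProduct_sumElim, dotProduct_zero, add_zero,
    Matrix.dotProduct_mulVec, ← Matrix.mulVec_transpose, Matrix.mulVec_mulVec,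
    headMatrix_transpose_mul k h₁ h₂, Matrix.one_mulVec]

/-- The condition on `w` makes it fixed by `headTail`, so that factor disappears. -/
theorem headVec_dotProduct_top (hl : l₁ ≤ l₂) (h₁ : 0 < l₁) (X : Matrix (Idx l₁ l₂) (Idx l₁ l₂) k)
    {w : Fin 2 → k} (hw : l₁ < l₂ → w 0 = 0) (u : Fin 2 → k) :
    headVec l₁ l₂ w ⬝ᵥ (nilpotentPart X ^ l₂).mulVec ((linearPart X).mulVec (headVec l₁ l₂ u)) =
      w ⬝ᵥ (tailRows X * headCols X).mulVec u := by
  have hT : (headTail k l₁ l₂).mulVec w = w := by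
    ext b
    rw [headTail, Matrix.mulVec_diagonal]
    split_ifs with hb
    · rw [hb.1, hw hb.2, zero_mul]
    · rw [one_mul]
  have hT' : (headTail k l₁ l₂).transpose = headTail k l₁ l₂ := Matrix.diagonal_transpose _
  rw [nilpotentPart_pow_top hl h₁, linearPart, headVec, headVec, Matrix.fromBlocks_mulVec,
    Matrix.fromBlocks_mulVec, sumElim_dotProduct_sumElim, zero_dotProduct, add_zero]
  simp only [Sum.elim_comp_inl, Sum.elim_comp_inr, Matrix.zero_mulVec, Matrix.mulVec_zero, zero_add,
    add_zero]
  rw [Matrix.mulVec_mulVec, Matrix.mulVec_mulVec, Matrix.mul_assoc, Matrix.mul_assoc, Matrix.mul_assoc,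
    ← Matrix.mulVec_mulVec _ (headMatrix k l₁ l₂), Matrix.dotProduct_mulVec _ (headMatrix k l₁ l₂),
    ← Matrix.mulVec_transpose, Matrix.mulVec_mulVec,
    headMatrix_transpose_mul k h₁ (h₁.trans_le hl), Matrix.one_mulVec, ← Matrix.mulVec_mulVec,
    Matrix.dotProduct_mulVec, ← Matrix.mulVec_transpose, hT', hT, headCols]

/-- The powers `b` and `b - 1` of the Jordan pair occurring in `N ^ b` are both at least `l₁`, hence
zero on the first block. -/
theorem head_fst_eq_zero {X : Matrix (Idx l₁ l₂) (Idx l₁ l₂) k} {b : ℕ} (hb : l₁ < b)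
    (z : Idx l₁ l₂ → k) :
    (headMatrix k l₁ l₂).transpose.mulVec (((nilpotentPart X ^ b).mulVec z) ∘ Sum.inl) 0 = 0 := by
  obtain ⟨c, rfl⟩ : ∃ c, b = c + 1 := ⟨b - 1, by omega⟩
  have h1 : ∀ d, l₁ ≤ d → ∀ y : Fin l₁ ⊕ Fin l₂ → k, ∀ a : Fin l₁,
      (jordanPair k l₁ l₂ ^ d).mulVec y (Sum.inl a) = 0 := by
    intro d hd y a
    rw [jordanPair_pow, Matrix.fromBlocks_mulVec, Sum.elim_inl, Matrix.zero_mulVec, add_zero]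
    rw [Matrix.mulVec, dotProduct]
    refine Finset.sum_eq_zero fun j _ => ?_
    rw [jordanBlock_pow_apply, if_neg (by omega), zero_mul]
  rw [nilpotentPart_pow_succ, Matrix.fromBlocks_mulVec, Sum.elim_comp_inl]
  rw [Matrix.mulVec, dotProduct]
  refine Finset.sum_eq_zero fun i _ => ?_
  rcases i with a | a
  · rw [Pi.add_apply, h1 _ (by omega), ← Matrix.mulVec_mulVec, h1 _ (by omega), add_zero, mul_zero]
  · simp [headMatrix]

/-- The key injectivity statement for the derivative of `φ_{l₁}` on the special fiber. -/
theorem eq_zero_of_moments (hl : l₁ ≤ l₂) (h₁ : 0 < l₁) {X : Matrix (Idx l₁ l₂) (Idx l₁ l₂) k}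
    (hP : (tailRows X).det ≠ 0) {w : Fin 2 → k} (hw : l₁ < l₂ → w 0 = 0)
    (hind : ∀ u : Fin 2 → k, w ⬝ᵥ u = 0 → w ⬝ᵥ (tailRows X * headCols X).mulVec u = 0 → u = 0)
    {z : Idx l₁ l₂ → k}
    (h1 : ∀ i ≤ l₂, headVec l₁ l₂ w ⬝ᵥ (nilpotentPart X ^ i).mulVec z = 0)
    (h2 : ∀ b ≤ l₁, ∑ x ∈ Finset.range (l₂ + 1), ∑ y ∈ Finset.range (l₂ + 1),
      (if l₂ + b = x + y then headVec l₁ l₂ w ⬝ᵥ (nilpotentPart X ^ x).mulVec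
        ((linearPart X).mulVec ((nilpotentPart X ^ y).mulVec z)) else 0) = 0) : z = 0 := by
  classical
  by_contra hz
  have hex : ∃ b, (nilpotentPart X ^ b).mulVec z = 0 :=
    ⟨l₂ + 1, by rw [nilpotentPart_pow_eq_zero hl, Matrix.zero_mulVec]⟩
  -- `b` is the last exponent with `N ^ b z ≠ 0`.
  obtain ⟨b, hb⟩ : ∃ b, Nat.find hex = b + 1 := by
    refine Nat.exists_eq_succ_of_ne_zero fun h0 => hz ?_
    have := Nat.find_spec hex
    rwa [h0, pow_zero, Matrix.one_mulVec] at this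
  have hbl : b ≤ l₂ := by
    have := Nat.find_min' hex (m := l₂ + 1)
      (by rw [nilpotentPart_pow_eq_zero hl, Matrix.zero_mulVec])
    omega
  have hne : (nilpotentPart X ^ b).mulVec z ≠ 0 := Nat.find_min hex (by omega)
  have hzero : ∀ y, b < y → (nilpotentPart X ^ y).mulVec z = 0 := by
    intro y hy
    have h3 := Nat.find_spec hex
    rw [hb] at h3
    obtain ⟨c, rfl⟩ : ∃ c, y = c + (b + 1) := ⟨y - (b + 1), by omega⟩
    rw [pow_add, ← Matrix.mulVec_mulVec, h3, Matrix.mulVec_zero]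
  have hker : (nilpotentPart X).mulVec ((nilpotentPart X ^ b).mulVec z) = 0 := by
    rw [Matrix.mulVec_mulVec, ← pow_succ', hzero _ (by omega)]
  have hv := eq_headVec_of_mulVec_eq_zero hP hker
  set u := (headMatrix k l₁ l₂).transpose.mulVec (((nilpotentPart X ^ b).mulVec z) ∘ Sum.inl)
    with hu
  have hwu : w ⬝ᵥ u = 0 := by
    rw [← headVec_dotProduct_headVec h₁ (h₁.trans_le hl), ← hv]
    exact h1 b hbl
  have hu0 : u = 0 := by
    refine hind u hwu ?_
    -- For `b > l₁` the family `h2` gives nothing. But then `l₁ < l₂`, so `w` and `u` are both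
    -- supported on the second block and `w · u = 0` already decides.
    rcases Nat.lt_or_ge l₁ b with hlb | hlb
    · have hu0 : u 0 = 0 := head_fst_eq_zero hlb z
      have hw0 := hw (by omega)
      rw [dotProduct, Fin.sum_univ_two, hw0, zero_mul, zero_add] at hwu
      rcases mul_eq_zero.mp hwu with hw1 | hu1
      · have hw00 : w = 0 := by
          ext i
          fin_cases i
          · exact hw0
          · exact hw1
        rw [hw00, zero_dotProduct]
      · have : u = 0 := by
          ext i
          fin_cases i
          · exact hu0
          · exact hu1
        rw [this, Matrix.mulVec_zero, dotProduct_zero]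
    · have h3 := h2 b hlb
      rw [Finset.sum_eq_single_of_mem l₂ (by simp), Finset.sum_eq_single_of_mem b
        (Finset.mem_range.mpr (by omega)), if_pos rfl, hv, headVec_dotProduct_top hl h₁ X hw] at h3
      · exact h3
      · intro y _ hy
        rw [if_neg (by omega)]
      · intro x hx hxl
        refine Finset.sum_eq_zero fun y _ => ?_
        split_ifs with hxy
        · rw [hzero y (by have := Finset.mem_range.mp hx; omega), Matrix.mulVec_zero,
            Matrix.mulVec_zero, dotProduct_zero]
        · rfl
  apply hne
  rw [hv, hu0, headVec, Matrix.mulVec_zero]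
  ext (i | i) <;> rfl

/-- A non-scalar matrix of size two has a covector which is not an eigenvector. -/
theorem exists_covector_of_not_scalar (M : Matrix (Fin 2) (Fin 2) k)
    (hM : ∀ μ : k, M ≠ μ • (1 : Matrix (Fin 2) (Fin 2) k)) :
    ∃ w : Fin 2 → k, ∀ u : Fin 2 → k, w ⬝ᵥ u = 0 → w ⬝ᵥ M.mulVec u = 0 → u = 0 := by
  -- The nonvanishing quantity is the determinant of the matrix with rows `w` and `w M`.
  have key : ∀ w : Fin 2 → k, w 0 * (w 0 * M 0 1 + w 1 * M 1 1) - w 1 * (w 0 * M 0 0 + w 1 * M 1 0)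
      ≠ 0 → ∀ u : Fin 2 → k, w ⬝ᵥ u = 0 → w ⬝ᵥ M.mulVec u = 0 → u = 0 := by
    intro w hw u h1 h2
    simp only [dotProduct, Matrix.mulVec, Fin.sum_univ_two] at h1 h2
    ext i
    fin_cases i
    · refine (mul_eq_zero.mp (?_ : _ * u 0 = 0)).resolve_left hw
      linear_combination (w 0 * M 0 1 + w 1 * M 1 1) * h1 - w 1 * h2
    · refine (mul_eq_zero.mp (?_ : _ * u 1 = 0)).resolve_left hw
      linear_combination w 0 * h2 - (w 0 * M 0 0 + w 1 * M 1 0) * h1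
  by_cases h01 : M 0 1 = 0
  · by_cases h10 : M 1 0 = 0
    · refine ⟨![1, 1], key _ fun h => hM (M 0 0) ?_⟩
      simp [h01, h10] at h
      ext i j
      fin_cases i <;> fin_cases j <;> simp [h01, h10]
      linear_combination h
    · exact ⟨![0, 1], key _ (by simpa using h10)⟩
  · exact ⟨![1, 0], key _ (by simpa using h01)⟩

end Core

/-! ### Variation of the special coordinates along rank-one directions. -/

section Derivative

variable {R : Type*} [CommRing R] {ι : Type*} [Fintype ι] [DecidableEq ι]

theorem geomSeries_mulVec (d : ℕ) (N : Matrix ι ι R) (z : ι → R) :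
    (geomSeries d N).mulVec (C ∘ z) =
      ∑ k ∈ Finset.range d, (X : R[X]) ^ k • (C ∘ (N ^ k).mulVec z) := by
  rw [geomSeries, Matrix.sum_mulVec]
  refine Finset.sum_congr rfl fun k _ => ?_
  rw [Matrix.smul_mulVec]
  congr 1
  exact funext fun i => (RingHom.map_mulVec C (N ^ k) z i).symm

theorem dotProduct_geomSeries_mulVec (d : ℕ) (N : Matrix ι ι R) (w z : ι → R) :
    (C ∘ w) ⬝ᵥ (geomSeries d N).mulVec (C ∘ z) =
      ∑ k ∈ Finset.range d, C (w ⬝ᵥ (N ^ k).mulVec z) * X ^ k := by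
  rw [geomSeries_mulVec, dotProduct_sum]
  refine Finset.sum_congr rfl fun k _ => ?_
  rw [dotProduct_smul, ← RingHom.map_dotProduct, smul_eq_mul, mul_comm]

theorem dotProduct_geomSeries_mul_mulVec (d : ℕ) (N B : Matrix ι ι R) (w z : ι → R) :
    (C ∘ w) ⬝ᵥ (geomSeries d N).mulVec ((B.map C).mulVec ((geomSeries d N).mulVec (C ∘ z))) =
      ∑ x ∈ Finset.range d, ∑ y ∈ Finset.range d,
        C (w ⬝ᵥ (N ^ x).mulVec (B.mulVec ((N ^ y).mulVec z))) * X ^ (x + y) := by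
  have h1 : (B.map C).mulVec ((geomSeries d N).mulVec (C ∘ z)) =
      ∑ y ∈ Finset.range d, (X : R[X]) ^ y • (C ∘ (B.mulVec ((N ^ y).mulVec z))) := by
    rw [geomSeries_mulVec, Matrix.mulVec_sum]
    refine Finset.sum_congr rfl fun y _ => ?_
    rw [Matrix.mulVec_smul]
    congr 1
    exact funext fun i => (RingHom.map_mulVec C B _ i).symm
  rw [h1, Matrix.mulVec_sum, dotProduct_sum, Finset.sum_comm]
  refine Finset.sum_congr rfl fun y _ => ?_
  rw [Matrix.mulVec_smul, dotProduct_smul, dotProduct_geomSeries_mulVec, smul_eq_mul,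
    Finset.mul_sum]
  refine Finset.sum_congr rfl fun x _ => ?_
  rw [pow_add]
  ring

variable {l₁ l₂ : ℕ}

/-- The polynomial whose coefficients are the variations of the sums of minors of size two along
`vecMulVec z w`. -/
noncomputable def variationPoly (A : Matrix (Idx l₁ l₂) (Idx l₁ l₂) R) (w z : Idx l₁ l₂ → R) :
    R[X] :=
  (perturbation (l₂ + 1) (nilpotentPart A) (linearPart A)).trace *
      ((C ∘ w) ⬝ᵥ -((X : R[X]) • (geomSeries (l₂ + 1) (nilpotentPart A)).mulVec (C ∘ z))) -
    (C ∘ w) ⬝ᵥ (perturbation (l₂ + 1) (nilpotentPart A) (linearPart A)).mulVec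
      (-((X : R[X]) • (geomSeries (l₂ + 1) (nilpotentPart A)).mulVec (C ∘ z)))

/-- The variation of the coordinates of `φ_{l₁}` on the special fiber along `vecMulVec z w`. -/
noncomputable def variation (A : Matrix (Idx l₁ l₂) (Idx l₁ l₂) R) (w z : Idx l₁ l₂ → R)
    (i : ℕ) : R :=
  if i ≤ l₂ then -(w ⬝ᵥ (nilpotentPart A ^ i).mulVec z) else (variationPoly A w z).coeff (i + 1)

theorem variationPoly_add (A : Matrix (Idx l₁ l₂) (Idx l₁ l₂) R) (w z z' : Idx l₁ l₂ → R) :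
    variationPoly A w (z + z') = variationPoly A w z + variationPoly A w z' := by
  have h : (C ∘ (z + z') : Idx l₁ l₂ → R[X]) = C ∘ z + C ∘ z' := by
    ext i : 1
    simp
  simp only [variationPoly, h, Matrix.mulVec_add, smul_add, neg_add, dotProduct_add]
  ring

theorem variationPoly_smul (A : Matrix (Idx l₁ l₂) (Idx l₁ l₂) R) (w z : Idx l₁ l₂ → R) (a : R) :
    variationPoly A w (a • z) = C a * variationPoly A w z := by
  have h : (C ∘ (a • z) : Idx l₁ l₂ → R[X]) = C a • (C ∘ z) := by
    ext i : 1
    simp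
  simp only [variationPoly, h, Matrix.mulVec_smul, smul_comm _ (C a), ← smul_neg, dotProduct_smul,
    smul_eq_mul]
  ring

theorem variation_add (A : Matrix (Idx l₁ l₂) (Idx l₁ l₂) R) (w z z' : Idx l₁ l₂ → R) (i : ℕ) :
    variation A w (z + z') i = variation A w z i + variation A w z' i := by
  rw [variation, variation, variation, variationPoly_add, Matrix.mulVec_add, dotProduct_add,
    coeff_add]
  split_ifs
  · ring
  · rfl

theorem variation_smul (A : Matrix (Idx l₁ l₂) (Idx l₁ l₂) R) (w z : Idx l₁ l₂ → R) (a : R)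
    (i : ℕ) : variation A w (a • z) i = a * variation A w z i := by
  rw [variation, variation, variationPoly_smul, Matrix.mulVec_smul, dotProduct_smul,
    coeff_C_mul, smul_eq_mul]
  split_ifs
  · ring
  · rfl

theorem map_variation {S : Type*} [CommRing S] (f : R →+* S)
    (A : Matrix (Idx l₁ l₂) (Idx l₁ l₂) R) (w z : Idx l₁ l₂ → R) (i : ℕ) :
    variation (A.map f) (f ∘ w) (f ∘ z) i = f (variation A w z i) := by
  have hC : ∀ y : Idx l₁ l₂ → R, (C ∘ f ∘ y : Idx l₁ l₂ → S[X]) = mapRingHom f ∘ C ∘ y := by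
    intro y
    ext i : 1
    simp
  have hmv : ∀ (M : Matrix (Idx l₁ l₂) (Idx l₁ l₂) R[X]) (y : Idx l₁ l₂ → R[X]),
      (M.map (mapRingHom f)).mulVec (mapRingHom f ∘ y) = mapRingHom f ∘ M.mulVec y :=
    fun M y => funext fun i => (RingHom.map_mulVec (mapRingHom f) M y i).symm
  have hu : -((X : S[X]) • (geomSeries (l₂ + 1) (nilpotentPart (A.map f))).mulVec (C ∘ f ∘ z)) =
      mapRingHom f ∘ (-((X : R[X]) • (geomSeries (l₂ + 1) (nilpotentPart A)).mulVec (C ∘ z))) := by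
    rw [← map_nilpotentPart, ← map_geomSeries, hC, hmv]
    ext i : 1
    simp
  have hpoly : variationPoly (A.map f) (f ∘ w) (f ∘ z) =
      mapRingHom f (variationPoly A w z) := by
    have htr : ∀ M : Matrix (Idx l₁ l₂) (Idx l₁ l₂) R[X],
        (M.map (mapRingHom f)).trace = mapRingHom f M.trace := by
      intro M
      rw [Matrix.trace, Matrix.trace, map_sum]
      rfl
    rw [variationPoly, hu, ← map_nilpotentPart, ← map_linearPart, ← map_perturbation, htr, hmv, hC,
      ← RingHom.map_dotProduct, ← RingHom.map_dotProduct, ← map_mul, ← map_sub]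
    rfl
  rw [variation, variation, hpoly, coe_mapRingHom, coeff_map, apply_ite f, map_neg,
    RingHom.map_dotProduct]
  have h1 : (nilpotentPart (A.map f)) ^ i = (nilpotentPart A ^ i).map f := by
    rw [← map_nilpotentPart]
    exact (map_pow f.mapMatrix (nilpotentPart A) i).symm
  have h2 : (f ∘ (nilpotentPart A ^ i).mulVec z) = ((nilpotentPart A ^ i).map f).mulVec (f ∘ z) :=
    funext fun j => RingHom.map_mulVec f _ z j
  rw [h1, h2]

theorem nilpotentPart_add_vecMulVec (A : Matrix (Idx l₁ l₂) (Idx l₁ l₂) R) {w : Idx l₁ l₂ → R}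
    (hw : ∀ j, w (Sum.inr j) = 0) (z : Idx l₁ l₂ → R) :
    nilpotentPart (A + Matrix.vecMulVec z w) = nilpotentPart A := by
  rw [nilpotentPart, nilpotentPart]
  congr 1
  ext i j
  simp [Matrix.toBlocks₁₂, Matrix.vecMulVec_apply, hw]

theorem linearPart_add_vecMulVec (A : Matrix (Idx l₁ l₂) (Idx l₁ l₂) R) {w : Idx l₁ l₂ → R}
    (hw : ∀ j, w (Sum.inr j) = 0) (z : Idx l₁ l₂ → R) :
    linearPart (A + Matrix.vecMulVec z w) = linearPart A + Matrix.vecMulVec z w := by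
  ext (i | i) (j | j) <;>
    simp [linearPart, Matrix.toBlocks₁₁, Matrix.toBlocks₂₁, Matrix.toBlocks₂₂,
      Matrix.vecMulVec_apply, hw]

variable {o : Type*} [CommRing o] [IsDomain o] {π : o} [Algebra o R]

/-- As `w` vanishes on the last two columns, only the linear part of the matrix moves, by `z wᵀ`.
Traces and sums of minors of size two are affine under such a change, so the formula is exact. -/
theorem phiHom_add_vecMulVec (hπ : π ≠ 0) (hπR : algebraMap o R π = 0) (h : l₁ ≤ l₂)
    (s₀ s : EndRing o l₁ l₂ →ₐ[o] R) {w : Idx l₁ l₂ → R} (hw : ∀ j, w (Sum.inr j) = 0)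
    (z : Idx l₁ l₂ → R) (hs : coordMatrix s = coordMatrix s₀ + Matrix.vecMulVec z w)
    (i : Fin (l₁ + l₂ + 2)) :
    s (phiHom π h (MvPolynomial.X i)) =
      s₀ (phiHom π h (MvPolynomial.X i)) + variation (coordMatrix s₀) w z i := by
  rw [variation]
  split_ifs with hi
  · rw [phiHom_special_low hπ hπR h s i hi, phiHom_special_low hπ hπR h s₀ i hi, hs,
      nilpotentPart_add_vecMulVec _ hw, linearPart_add_vecMulVec _ hw, mul_add, Matrix.trace_add,
      Matrix.mul_vecMulVec, Matrix.trace_vecMulVec, neg_add, dotProduct_comm w]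
  · rw [phiHom_special_high hπ hπR h s i (by omega), phiHom_special_high hπ hπR h s₀ i (by omega),
      hs, nilpotentPart_add_vecMulVec _ hw, linearPart_add_vecMulVec _ hw,
      perturbation_add_vecMulVec, minorSum₂_add_vecMulVec, coeff_add]
    rfl

end Derivative

/-! ### Surjectivity of the tangent map where the uniformizer vanishes. -/

section SpecialPoint

variable {k : Type*} [Field k] {l₁ l₂ : ℕ}

theorem variation_injective (hl : l₁ ≤ l₂) (h₁ : 0 < l₁) {A : Matrix (Idx l₁ l₂) (Idx l₁ l₂) k}
    (hP : (tailRows A).det ≠ 0) {w : Fin 2 → k} (hw : l₁ < l₂ → w 0 = 0)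
    (hind : ∀ u : Fin 2 → k, w ⬝ᵥ u = 0 → w ⬝ᵥ (tailRows A * headCols A).mulVec u = 0 → u = 0)
    {z : Idx l₁ l₂ → k}
    (hz : ∀ i : Fin (l₁ + l₂ + 2), variation A (headVec l₁ l₂ w) z i = 0) : z = 0 := by
  have h1 : ∀ i ≤ l₂, headVec l₁ l₂ w ⬝ᵥ (nilpotentPart A ^ i).mulVec z = 0 := by
    intro i hi
    have h2 := hz ⟨i, by omega⟩
    rw [variation, if_pos hi, neg_eq_zero] at h2
    exact h2
  refine eq_zero_of_moments hl h₁ hP hw hind h1 fun b hb => ?_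
  have h2 := hz ⟨l₂ + b + 1, by omega⟩
  -- The first `l₂ + 1` equations kill `w · U z` with `U` the geometric series, so only `w · U B U
  -- z` remains in the others. It carries two factors `X`, which turn the coefficient of degree `l₂
  -- + b + 2` into that of degree `l₂ + b`.
  have h3 : (C ∘ headVec l₁ l₂ w) ⬝ᵥ
      (geomSeries (l₂ + 1) (nilpotentPart A)).mulVec (C ∘ z) = 0 := by
    rw [dotProduct_geomSeries_mulVec]
    refine Finset.sum_eq_zero fun i hi => ?_
    rw [h1 i (by have := Finset.mem_range.mp hi; omega), C_0, zero_mul]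
  rw [variation, if_neg (by simp only; omega), variationPoly, dotProduct_neg, dotProduct_smul, h3,
    smul_zero, neg_zero, mul_zero, zero_sub, perturbation, Matrix.neg_mulVec_neg,
    Matrix.smul_mulVec, Matrix.mulVec_smul, dotProduct_smul, dotProduct_smul, coeff_neg,
    neg_eq_zero, smul_eq_mul, smul_eq_mul, coeff_X_mul, coeff_X_mul, ← Matrix.mulVec_mulVec,
    dotProduct_geomSeries_mul_mulVec] at h2
  simpa only [finsetSum_coeff, coeff_C_mul_X_pow] using h2

variable {o : Type*} [CommRing o] [IsDomain o] {π : o} [Algebra o k]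

/-- For `M = tailRows * headCols`, the last coordinate is `det M` and the coordinate of index `l₂`
is minus the trace of `headTail * M`. For `l₁ < l₂` that trace is the entry `M 1 1`, and the second
coordinate covector works; for `l₁ = l₂` it is the full trace, and the last hypothesis says that `M`
is not scalar. -/
theorem exists_covector (hπ : π ≠ 0) (hπk : algebraMap o k π = 0) (hl : l₁ ≤ l₂) (h₁ : 0 < l₁)
    (x : EndRing o l₁ l₂ →ₐ[o] k)
    (hlast : x (phiHom π hl (MvPolynomial.X (Fin.last (l₁ + l₂ + 1)))) ≠ 0)
    (hlt : l₁ < l₂ → x (phiHom π hl (MvPolynomial.X ⟨l₂, by omega⟩)) = 0)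
    (heq : l₁ = l₂ → ∀ μ : k, x (phiHom π hl (MvPolynomial.X ⟨l₂, by omega⟩)) = -(2 * μ) →
      x (phiHom π hl (MvPolynomial.X (Fin.last (l₁ + l₂ + 1)))) ≠ μ ^ 2) :
    (tailRows (coordMatrix x)).det ≠ 0 ∧ ∃ w : Fin 2 → k, (l₁ < l₂ → w 0 = 0) ∧
      ∀ u : Fin 2 → k, w ⬝ᵥ u = 0 →
        w ⬝ᵥ (tailRows (coordMatrix x) * headCols (coordMatrix x)).mulVec u = 0 → u = 0 := by
  rw [phiHom_special_last hπ hπk hl h₁ x, det_dividedMatrix hl h₁] at hlast heq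
  rw [phiHom_special_low hπ hπk hl x ⟨l₂, by omega⟩ le_rfl, trace_nilpotentPart_pow_top hl h₁]
    at hlt heq
  set M := tailRows (coordMatrix x) * headCols (coordMatrix x) with hM
  refine ⟨fun h => hlast (by rw [hM, Matrix.det_mul, h, zero_mul]), ?_⟩
  rcases hl.lt_or_eq with hlt' | heq'
  · have h1 : M 1 1 = 0 := by
      have := hlt hlt'
      simpa [headTail, Matrix.trace, Matrix.diagonal_mul, hlt'] using this
    have h2 : M 1 0 ≠ 0 := by
      intro h
      rw [Matrix.det_fin_two, h1, h, mul_zero, mul_zero, sub_zero] at hlast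
      exact hlast rfl
    refine ⟨![0, 1], fun _ => rfl, fun u hu1 hu2 => ?_⟩
    simp only [dotProduct, Matrix.mulVec, Fin.sum_univ_two, Matrix.cons_val_zero,
      Matrix.cons_val_one, zero_mul, one_mul, zero_add, h1, add_zero] at hu1 hu2
    ext i
    fin_cases i
    · exact (mul_eq_zero.mp hu2).resolve_left h2
    · exact hu1
  · obtain ⟨w, hw⟩ := exists_covector_of_not_scalar M (by
      intro μ hμ
      refine heq heq' μ ?_ ?_
      · rw [hμ]
        simp [headTail, Matrix.trace, heq']
      · rw [hμ]
        simp)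
    exact ⟨w, fun h => absurd heq' h.ne, hw⟩

/-- Surjectivity of the tangent map at the points of the special fiber. -/
theorem tangentMap_surjective_special (hπ : π ≠ 0) (hπk : algebraMap o k π = 0) (hl : l₁ ≤ l₂)
    (h₁ : 0 < l₁) (x : EndRing o l₁ l₂ →ₐ[o] k)
    (hlast : x (phiHom π hl (MvPolynomial.X (Fin.last (l₁ + l₂ + 1)))) ≠ 0)
    (hlt : l₁ < l₂ → x (phiHom π hl (MvPolynomial.X ⟨l₂, by omega⟩)) = 0)
    (heq : l₁ = l₂ → ∀ μ : k, x (phiHom π hl (MvPolynomial.X ⟨l₂, by omega⟩)) = -(2 * μ) →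
      x (phiHom π hl (MvPolynomial.X (Fin.last (l₁ + l₂ + 1)))) ≠ μ ^ 2) :
    Function.Surjective (tangentMap (phiHom π hl) x) := by
  obtain ⟨hP, w, hw, hind⟩ := exists_covector hπ hπk hl h₁ x hlast hlt heq
  set w' := headVec l₁ l₂ w with hw'
  let L : (Idx l₁ l₂ → k) →ₗ[k] (Fin (l₁ + l₂ + 2) → k) :=
    { toFun := fun z i => variation (coordMatrix x) w' z i
      map_add' := fun z z' => funext fun i => variation_add _ _ _ _ _
      map_smul' := fun a z => funext fun i => variation_smul _ _ _ _ _ }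
  have hinj : Function.Injective L := by
    rw [← LinearMap.ker_eq_bot, LinearMap.ker_eq_bot']
    intro z hz
    exact variation_injective hl h₁ hP hw hind fun i => congrFun hz i
  -- The vector `z` has as many entries as there are coordinates on the target, so injectivity
  -- suffices.
  have hsurj : Function.Surjective L :=
    (LinearMap.injective_iff_surjective_of_finrank_eq_finrank (by simp)).mp hinj
  intro t
  obtain ⟨z, hz⟩ := hsurj fun i => (t.1 (MvPolynomial.X i)).snd
  let s₀ : EndRing o l₁ l₂ →ₐ[o] k[ε] := (TrivSqZeroExt.inlAlgHom o k k).comp x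
  let s : EndRing o l₁ l₂ →ₐ[o] k[ε] := MvPolynomial.aeval fun ij =>
    TrivSqZeroExt.inl (x (MvPolynomial.X ij)) + TrivSqZeroExt.inr (z ij.1 * w' ij.2)
  let f : k →+* k[ε] := TrivSqZeroExt.inlHom k k
  have hπε : algebraMap o k[ε] π = 0 := by
    rw [IsScalarTower.algebraMap_apply o k k[ε], hπk, map_zero]
  have hcoord₀ : coordMatrix s₀ = (coordMatrix x).map f := rfl
  have hcoord : coordMatrix s = coordMatrix s₀ +
      Matrix.vecMulVec ((TrivSqZeroExt.inr 1 : k[ε]) • (f ∘ z)) (f ∘ w') := by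
    refine Matrix.ext fun i j => ?_
    rw [Matrix.add_apply, Matrix.vecMulVec_apply]
    change s (MvPolynomial.X (i, j)) = TrivSqZeroExt.inl (x (MvPolynomial.X (i, j))) +
      TrivSqZeroExt.inr 1 * TrivSqZeroExt.inl (z i) * TrivSqZeroExt.inl (w' j)
    rw [MvPolynomial.aeval_X, TrivSqZeroExt.inr_mul_inl, TrivSqZeroExt.inr_mul_inl]
    simp [mul_comm]
  refine ⟨⟨s, fun b => ?_⟩, Subtype.ext ?_⟩
  · have : (TrivSqZeroExt.fstHom o k k).comp s = x := by
      refine MvPolynomial.algHom_ext fun ij => ?_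
      simp [s]
    exact DFunLike.congr_fun this b
  · change s.comp (phiHom π hl) = t.1
    refine MvPolynomial.algHom_ext fun i => ?_
    rw [AlgHom.comp_apply, phiHom_add_vecMulVec hπ hπε hl s₀ s (fun j => by simp [f, hw', headVec])
      _ hcoord, variation_smul, hcoord₀, map_variation]
    have h1 : variation (coordMatrix x) w' z i = (t.1 (MvPolynomial.X i)).snd := congrFun hz i
    have h2 := t.2 (MvPolynomial.X i)
    rw [h1]
    change TrivSqZeroExt.inl (x (phiHom π hl (MvPolynomial.X i))) +
      TrivSqZeroExt.inr 1 * TrivSqZeroExt.inl _ = _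
    rw [TrivSqZeroExt.inr_mul_inl]
    ext
    · simp [h2]
    · simp

end SpecialPoint

/-! ### Newton polygon of an irreducible polynomial. -/

section NewtonPolygon

/-- The spectral norm of a root is by definition the maximum of the slopes `‖c‖ ^ (1 / (deg f - j))`
over the coefficients. By completeness and irreducibility it also equals `‖f(0)‖ ^ (1 / deg f)`, so
the constant term dominates. -/
theorem norm_coeff_pow_le_of_irreducible {K : Type*} [NontriviallyNormedField K]
    [IsUltrametricDist K] [CompleteSpace K] {f : K[X]} (hf : f.Monic) (hirr : Irreducible f)
    {j : ℕ} (hj : j < f.natDegree) :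
    ‖f.coeff j‖ ^ f.natDegree ≤ ‖f.coeff 0‖ ^ (f.natDegree - j) := by
  have : Fact (Irreducible f) := ⟨hirr⟩
  have : FiniteDimensional K (AdjoinRoot f) := hf.finite_adjoinRoot
  have hmin : minpoly K (AdjoinRoot.root f) = f := by
    rw [AdjoinRoot.minpoly_root hirr.ne_zero, hf.leadingCoeff, inv_one, C_1, mul_one]
  have h1 := spectralNorm.spectralNorm_eq_norm_coeff_zero_rpow K (AdjoinRoot f)
    (AdjoinRoot.root f)
  rw [spectralNorm, hmin] at h1
  have h2 : spectralValueTerms f j ≤ spectralValue f :=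
    le_ciSup (spectralValueTerms_bddAbove f) j
  rw [h1, spectralValueTerms_of_lt_natDegree f hj, ← Nat.cast_sub hj.le] at h2
  have hn : (f.natDegree : ℝ) ≠ 0 := by
    exact_mod_cast (by omega : f.natDegree ≠ 0)
  have hnj : ((f.natDegree - j : ℕ) : ℝ) ≠ 0 := by
    exact_mod_cast (by omega : f.natDegree - j ≠ 0)
  have h3 := pow_le_pow_left₀ (by positivity) h2 (f.natDegree * (f.natDegree - j))
  rw [mul_comm, pow_mul, ← Real.rpow_natCast (_ ^ _) (f.natDegree - j), ← Real.rpow_mul (by positivity),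
    one_div_mul_cancel hnj, Real.rpow_one, mul_comm, pow_mul,
    ← Real.rpow_natCast (_ ^ _) f.natDegree, ← Real.rpow_mul (by positivity),
    one_div_mul_cancel hn, Real.rpow_one] at h3
  exact h3

/-- Transfers the norm inequality by choosing a rank-one norm that induces the valuation. -/
theorem valuation_coeff_pow_le_of_irreducible {F : Type*} [Field F] [ValuativeRel F]
    [TopologicalSpace F] [IsNonarchimedeanLocalField F] {f : F[X]} (hf : f.Monic)
    (hirr : Irreducible f) {j : ℕ} (hj : j < f.natDegree) :
    valuation F (f.coeff j) ^ f.natDegree ≤ valuation F (f.coeff 0) ^ (f.natDegree - j) := by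
  let := IsTopologicalAddGroup.rightUniformSpace F
  have := isUniformAddGroup_of_addCommGroup (G := F)
  let : (Valued.v (R := F)).RankOne :=
  { hom' := IsRankLeOne.nonempty.some.emb (R := F).comp MonoidWithZeroHom.ValueGroup₀.embedding
    strictMono' := IsRankLeOne.nonempty.some.strictMono.comp
        MonoidWithZeroHom.ValueGroup₀.embedding_strictMono }
  let := Valued.toNontriviallyNormedField (L := F) (Γ₀ := ValueGroupWithZero F)
  have hu : IsUltrametricDist F := inferInstance
  have hc : CompleteSpace F := inferInstance
  have h := norm_coeff_pow_le_of_irreducible hf hirr hj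
  rw [← norm_pow, ← norm_pow, Valued.toNormedField.norm_le_iff, map_pow, map_pow] at h
  exact h

variable {F : Type*} [Field F] [ValuativeRel F] [TopologicalSpace F]
  [IsNonarchimedeanLocalField F]

/-- The points `(j, v(c_j))` lie on or above the segment of slope `-d / deg φ`. The bound on `e`
says that `e - 1` is strictly below this segment at `j`, so integrality gives valuation at least
`e`. -/
theorem pow_dvd_coeff_of_irreducible {π : 𝒪[F]} (hπ : Irreducible π) {φ : 𝒪[F][X]}
    (hmonic : φ.Monic) (hirr : Irreducible φ) {d : ℕ}
    (hord : IsDiscreteValuationRing.addVal 𝒪[F] (φ.coeff 0) = d) {j e : ℕ}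
    (hj : j < φ.natDegree) (he : (e - 1) * φ.natDegree < d * (φ.natDegree - j)) :
    π ^ e ∣ φ.coeff j := by
  have hmonic' := hmonic.map (algebraMap 𝒪[F] F)
  have h1 := valuation_coeff_pow_le_of_irreducible hmonic'
    (hmonic.irreducible_iff_irreducible_map_fraction_map.mp hirr)
    (by rwa [hmonic.natDegree_map])
  rw [hmonic.natDegree_map, coeff_map, coeff_map, ← map_pow, ← map_pow, ← map_pow, ← map_pow] at h1
  have h2 : φ.coeff 0 ^ (φ.natDegree - j) ∣ φ.coeff j ^ φ.natDegree :=
    (Valuation.Integers.dvd_iff_le (Valuation.integer.integers (valuation F))).mpr h1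
  have h3 := (IsDiscreteValuationRing.addVal_le_iff_dvd).mpr h2
  rw [IsDiscreteValuationRing.addVal_pow, IsDiscreteValuationRing.addVal_pow, hord] at h3
  rw [← IsDiscreteValuationRing.addVal_le_iff_dvd, IsDiscreteValuationRing.addVal_pow,
    IsDiscreteValuationRing.addVal_uniformizer hπ]
  cases hv : IsDiscreteValuationRing.addVal 𝒪[F] (φ.coeff j) with
  | top => exact le_top
  | coe v =>
    rw [hv] at h3
    norm_cast at h3 ⊢
    simp only [nsmul_eq_mul, mul_one] at *
    norm_cast at h3 ⊢
    by_contra hlt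
    have : v ≤ e - 1 := by omega
    nlinarith [Nat.mul_le_mul_right φ.natDegree this]

end NewtonPolygon

/-! ### Rank-one variation of the characteristic polynomial. -/

section CharpolyVariation

variable {ι R : Type*} [Fintype ι] [DecidableEq ι] [CommRing R]

/-- Minus the first order variation of the characteristic polynomial of `A` in the direction of the
matrix `z wᵀ`. -/
noncomputable def charpolyVariation (A : Matrix ι ι R) (w z : ι → R) : R[X] :=
  (C ∘ w) ⬝ᵥ A.charmatrix.adjugate.mulVec (C ∘ z)

theorem charpolyVariation_add (A : Matrix ι ι R) (w z z' : ι → R) :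
    charpolyVariation A w (z + z') = charpolyVariation A w z + charpolyVariation A w z' := by
  have h : (C ∘ (z + z') : ι → R[X]) = C ∘ z + C ∘ z' := by ext1; simp
  rw [charpolyVariation, h, Matrix.mulVec_add, dotProduct_add]
  rfl

theorem charpolyVariation_smul (A : Matrix ι ι R) (w z : ι → R) (a : R) :
    charpolyVariation A w (a • z) = C a * charpolyVariation A w z := by
  have h : (C ∘ (a • z) : ι → R[X]) = C a • (C ∘ z) := by ext1; simp
  rw [charpolyVariation, h, Matrix.mulVec_smul, dotProduct_smul]
  rfl

theorem map_charpolyVariation {S : Type*} [CommRing S] (f : R →+* S) (A : Matrix ι ι R)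
    (w z : ι → R) :
    charpolyVariation (A.map f) (f ∘ w) (f ∘ z) = (charpolyVariation A w z).map f := by
  have hC : ∀ y : ι → R, (C ∘ f ∘ y : ι → S[X]) = mapRingHom f ∘ C ∘ y := by
    intro y
    ext i : 1
    simp
  have h1 : (A.map f).charmatrix.adjugate = A.charmatrix.adjugate.map (mapRingHom f) := by
    rw [Matrix.charmatrix_map]
    exact ((mapRingHom f).map_adjugate A.charmatrix).symm
  have h2 : (A.charmatrix.adjugate.map (mapRingHom f)).mulVec (mapRingHom f ∘ C ∘ z) =
      mapRingHom f ∘ A.charmatrix.adjugate.mulVec (C ∘ z) :=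
    funext fun i => (RingHom.map_mulVec (mapRingHom f) _ _ i).symm
  rw [charpolyVariation, h1, hC, hC, h2, ← RingHom.map_dotProduct]
  rfl

theorem charpoly_add_vecMulVec (A : Matrix ι ι R) (w z : ι → R) :
    (A + Matrix.vecMulVec z w).charpoly = A.charpoly - charpolyVariation A w z := by
  have h : (A + Matrix.vecMulVec z w).charmatrix =
      A.charmatrix + Matrix.vecMulVec (-(C ∘ z)) (C ∘ w) := by
    ext i j : 2
    simp [Matrix.charmatrix_apply, Matrix.vecMulVec_apply, sub_eq_add_neg, add_assoc, add_comm]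
  rw [Matrix.charpoly, h, det_add_vecMulVec, Matrix.mulVec_neg, dotProduct_neg, sub_eq_add_neg]
  rfl

/-- The variation is a difference of two monic polynomials of the same degree, so its `n` lower
coefficients determine it. -/
theorem coeff_charpolyVariation_eq_zero (A : Matrix ι ι R) (w z : ι → R) {i : ℕ}
    (hi : Fintype.card ι ≤ i) : (charpolyVariation A w z).coeff i = 0 := by
  nontriviality R
  have h : charpolyVariation A w z = A.charpoly - (A + Matrix.vecMulVec z w).charpoly := by
    rw [charpoly_add_vecMulVec, sub_sub_cancel]
  rw [h, coeff_sub]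
  rcases hi.eq_or_lt with rfl | hi
  · have h1 : ∀ B : Matrix ι ι R, B.charpoly.coeff (Fintype.card ι) = 1 := by
      intro B
      have := B.charpoly_monic
      rwa [Monic, leadingCoeff, B.charpoly_natDegree_eq_dim] at this
    rw [h1, h1, sub_self]
  · rw [coeff_eq_zero_of_natDegree_lt, coeff_eq_zero_of_natDegree_lt, sub_self] <;>
      rwa [Matrix.charpoly_natDegree_eq_dim]

end CharpolyVariation

/-! ### Surjectivity of the tangent map where the uniformizer is invertible. -/

section GenericPoint

variable {k : Type*} [Field k] [IsAlgClosed k]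

/-- The roots are simple, so there is a basis of left eigenvectors `v a`; their sum is a cyclic
covector. The variation along it is `∑ q a * (v a · z)` with `q a = charpoly / (X - a)`, and
evaluation at the roots separates the terms. -/
theorem exists_charpolyVariation_injective {ι : Type*} [Fintype ι] [DecidableEq ι]
    {A : Matrix ι ι k} (hA : A.charpoly.Separable) :
    ∃ w : ι → k, ∀ z, charpolyVariation A w z = 0 → z = 0 := by
  classical
  set S := A.charpoly.roots.toFinset with hS
  have hroot : ∀ a : S, A.charpoly.eval (a : k) = 0 := by
    intro a
    exact (mem_roots'.mp (Multiset.mem_toFinset.mp a.2)).2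
  have hex : ∀ a : S, ∃ v : ι → k, v ≠ 0 ∧ Matrix.vecMul v A = (a : k) • v := by
    intro a
    have h := hroot a
    rw [Matrix.eval_charpoly, ← Matrix.exists_vecMul_eq_zero_iff] at h
    obtain ⟨v, hv, h⟩ := h
    refine ⟨v, hv, ?_⟩
    rw [Matrix.vecMul_sub, sub_eq_zero] at h
    rw [← h]
    ext i
    simp [Matrix.scalar_apply, Matrix.vecMul_diagonal, mul_comm]
  choose v hv0 hv using hex
  have hli : LinearIndependent k v := by
    refine Module.End.eigenvectors_linearIndependent' (Matrix.vecMulLinear A)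
      (fun a : S => (a : k)) Subtype.val_injective v fun a => ?_
    rw [Module.End.hasEigenvector_iff, Module.End.mem_eigenspace_iff]
    exact ⟨hv a, hv0 a⟩
  have hcard : Fintype.card S = Module.finrank k (ι → k) := by
    rw [Fintype.card_coe, hS, Multiset.toFinset_card_of_nodup (nodup_roots hA),
      ← (IsAlgClosed.splits A.charpoly).natDegree_eq_card_roots, A.charpoly_natDegree_eq_dim,
      Module.finrank_fintype_fun_eq_card]
  have hspan := hli.span_eq_top_of_card_eq_finrank' hcard
  have hq : ∀ a : S, ∃ q : k[X], A.charpoly = (X - C (a : k)) * q := fun a =>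
    dvd_iff_isRoot.mpr (hroot a)
  choose q hq using hq
  have hadj : ∀ (a : S) (z : ι → k),
      charpolyVariation A (v a) z = q a * C (v a ⬝ᵥ z) := by
    intro a z
    have h1 : Matrix.vecMul (C ∘ v a) A.charmatrix = (X - C (a : k)) • (C ∘ v a) := by
      have h2 : Matrix.vecMul (C ∘ v a) (C.mapMatrix A) = C (a : k) • (C ∘ v a) := by
        ext1 i
        have := (RingHom.map_vecMul (C : k →+* k[X]) A (v a) i).symm
        rw [hv a] at this
        simpa using this
      rw [Matrix.charmatrix, Matrix.vecMul_sub, h2, sub_smul]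
      congr 1
      ext1 i
      rw [Matrix.scalar_apply, Matrix.vecMul_diagonal, Pi.smul_apply, smul_eq_mul, mul_comm]
    -- Multiply the eigenvector relation by the adjugate; the factor `X - a` can then be cancelled.
    have h3 : (X - C (a : k)) • Matrix.vecMul (C ∘ v a) A.charmatrix.adjugate =
        (X - C (a : k)) • q a • (C ∘ v a) := by
      rw [← Matrix.smul_vecMul, ← h1, Matrix.vecMul_vecMul, Matrix.mul_adjugate,
        ← Matrix.charpoly, hq a, Matrix.vecMul_smul, Matrix.vecMul_one, mul_smul]
    have h4 := smul_right_injective _ (X_sub_C_ne_zero (a : k)) h3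
    rw [charpolyVariation, Matrix.dotProduct_mulVec, h4, smul_dotProduct, ← RingHom.map_dotProduct,
      smul_eq_mul]
  refine ⟨∑ a, v a, fun z hz => ?_⟩
  have hsum : charpolyVariation A (∑ a, v a) z = ∑ a, q a * C (v a ⬝ᵥ z) := by
    rw [← Finset.sum_congr rfl fun a _ => hadj a z]
    simp only [charpolyVariation]
    rw [← sum_dotProduct]
    congr 1
    ext1 i
    simp [Finset.sum_apply]
  have hvz : ∀ a, v a ⬝ᵥ z = 0 := by
    intro a
    have h1 := congrArg (eval (a : k)) (hsum.symm.trans hz)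
    rw [eval_finsetSum, eval_zero, Finset.sum_eq_single a] at h1
    · rw [eval_mul, eval_C] at h1
      refine (mul_eq_zero.mp h1).resolve_left fun h => ?_
      -- The value of `q a` at `a` is the derivative of the characteristic polynomial there, nonzero
      -- at a simple root.
      have h2 : eval (a : k) (derivative A.charpoly) = 0 := by
        rw [hq a]
        simp [derivative_mul, h]
      exact hA.eval₂_derivative_ne_zero (RingHom.id k) (by rw [eval₂_id]; exact hroot a)
        (by rw [eval₂_id]; exact h2)
    · intro b _ hb
      have h2 := hroot a
      rw [hq b, eval_mul, eval_sub, eval_X, eval_C] at h2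
      rw [eval_mul, (mul_eq_zero.mp h2).resolve_left fun h => hb (Subtype.ext (sub_eq_zero.mp h).symm),
        zero_mul]
    · simp
  have hall : ∀ y : ι → k, y ⬝ᵥ z = 0 := by
    intro y
    have hy : y ∈ Submodule.span k (Set.range v) := hspan ▸ Submodule.mem_top
    induction hy using Submodule.span_induction with
    | mem y hy => obtain ⟨a, rfl⟩ := hy; exact hvz a
    | zero => exact zero_dotProduct z
    | add y y' _ _ h h' => rw [add_dotProduct, h, h', add_zero]
    | smul a y _ h => rw [smul_dotProduct, h, smul_zero]
  ext i
  simpa using hall (Pi.single i 1)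

variable {o : Type*} [CommRing o] [IsDomain o] {π : o} [Algebra o k] {l₁ l₂ : ℕ}

/-- Once `π` is invertible, every direction `Z` in matrix space is tangent to the space of
congruence matrices: rescale the blocks that carry a factor `π`. -/
theorem congruenceMatrix_add {R : Type*} [CommRing R] {r u : R} (hru : r * u = 1)
    (X Z : Matrix (Idx l₁ l₂) (Idx l₁ l₂) R) :
    congruenceMatrix r (X + Matrix.fromBlocks (u • Z.toBlocks₁₁) Z.toBlocks₁₂
      (u • Z.toBlocks₂₁) (u • Z.toBlocks₂₂)) = congruenceMatrix r X + Z := by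
  have h : ∀ a b : R, r * (a + u * b) = r * a + b := fun a b => by
    rw [mul_add, ← mul_assoc, hru, one_mul]
  ext (i | i) (j | j) <;>
    simp [congruenceMatrix, Matrix.toBlocks₁₁, Matrix.toBlocks₁₂, Matrix.toBlocks₂₁,
      Matrix.toBlocks₂₂, h, add_assoc]

/-- Surjectivity of the tangent map at the points of the generic fiber whose characteristic
polynomial is separable. -/
theorem tangentMap_surjective_generic (hπk : algebraMap o k π ≠ 0) (hl : l₁ ≤ l₂)
    (x : EndRing o l₁ l₂ →ₐ[o] k) (hsep : ((universalMatrix π l₁ l₂).map x).charpoly.Separable) :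
    Function.Surjective (tangentMap (phiHom π hl) x) := by
  set A := (universalMatrix π l₁ l₂).map x with hA
  set p := algebraMap o k π with hp
  obtain ⟨w, hw⟩ := exists_charpolyVariation_injective hsep
  have hcard : Fintype.card (Idx l₁ l₂) = l₁ + l₂ + 2 := by simp [Idx]
  let L : (Idx l₁ l₂ → k) →ₗ[k] (Fin (l₁ + l₂ + 2) → k) :=
    { toFun := fun z i => -coeffVec (l₁ + l₂ + 2) (charpolyVariation A w z) i
      map_add' := fun z z' => funext fun i => by
        simp [charpolyVariation_add, coeffVec, add_comm]
      map_smul' := fun a z => funext fun i => by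
        simp [charpolyVariation_smul, coeffVec] }
  have hinj : Function.Injective L := by
    rw [← LinearMap.ker_eq_bot, LinearMap.ker_eq_bot']
    intro z hz
    refine hw z (Polynomial.ext fun i => ?_)
    rw [coeff_zero]
    rcases le_or_gt (l₁ + l₂ + 2) i with hi | hi
    · exact coeff_charpolyVariation_eq_zero A w z (hcard.trans_le hi)
    · have h := neg_eq_zero.mp (congrFun hz ⟨l₁ + l₂ + 1 - i, by omega⟩)
      rw [coeffVec] at h
      convert h using 2
      simp only
      omega
  have hsurj : Function.Surjective L :=
    (LinearMap.injective_iff_surjective_of_finrank_eq_finrank (by simp)).mp hinj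
  intro t
  obtain ⟨z, hz⟩ := hsurj fun i => p ^ expo l₂ i * (t.1 (MvPolynomial.X i)).snd
  let f : k →+* k[ε] := TrivSqZeroExt.inlHom k k
  have hπε : algebraMap o k[ε] π = f p := IsScalarTower.algebraMap_apply o k k[ε] π
  let Z : Matrix (Idx l₁ l₂) (Idx l₁ l₂) k[ε] :=
    Matrix.vecMulVec ((TrivSqZeroExt.inr 1 : k[ε]) • (f ∘ z)) (f ∘ w)
  let Y : Matrix (Idx l₁ l₂) (Idx l₁ l₂) k[ε] :=
    Matrix.fromBlocks (f p⁻¹ • Z.toBlocks₁₁) Z.toBlocks₁₂ (f p⁻¹ • Z.toBlocks₂₁)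
      (f p⁻¹ • Z.toBlocks₂₂)
  have hY : ∀ i j, (Y i j).fst = 0 := by
    have hZ : ∀ i j, (Z i j).fst = 0 := by
      intro i j
      simp [Z, Matrix.vecMulVec_apply]
    rintro (i | i) (j | j)
    · exact (congrArg (fun y => p⁻¹ * y) (hZ (Sum.inl i) (Sum.inl j))).trans (mul_zero _)
    · exact hZ _ _
    · exact (congrArg (fun y => p⁻¹ * y) (hZ (Sum.inr i) (Sum.inl j))).trans (mul_zero _)
    · exact (congrArg (fun y => p⁻¹ * y) (hZ (Sum.inr i) (Sum.inr j))).trans (mul_zero _)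
  let s₀ : EndRing o l₁ l₂ →ₐ[o] k[ε] := (TrivSqZeroExt.inlAlgHom o k k).comp x
  let s : EndRing o l₁ l₂ →ₐ[o] k[ε] := MvPolynomial.aeval fun ij =>
    s₀ (MvPolynomial.X ij) + Y ij.1 ij.2
  have hs : (universalMatrix π l₁ l₂).map s = A.map f + Z := by
    have h₀ : A.map f = (universalMatrix π l₁ l₂).map s₀ := by
      rw [hA, Matrix.map_map]
      rfl
    rw [h₀, map_universalMatrix, map_universalMatrix, hπε, ← congruenceMatrix_add (r := f p)
      (u := f p⁻¹) (by rw [← map_mul, mul_inv_cancel₀ hπk, map_one])]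
    congr 1
    refine Matrix.ext fun i j => ?_
    simp only [Matrix.of_apply, Matrix.add_apply, s, MvPolynomial.aeval_X]
    rfl
  refine ⟨⟨s, fun b => ?_⟩, Subtype.ext ?_⟩
  · have : (TrivSqZeroExt.fstHom o k k).comp s = x := by
      refine MvPolynomial.algHom_ext fun ij => ?_
      simp [s, s₀, hY]
    exact DFunLike.congr_fun this b
  · change s.comp (phiHom π hl) = t.1
    refine MvPolynomial.algHom_ext fun i => ?_
    have h1 := phiHom_spec π hl s i
    have h2 := congrArg f (phiHom_spec π hl x i)
    have h3 : -coeffVec (l₁ + l₂ + 2) (charpolyVariation A w z) i = _ := congrFun hz i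
    have h4 : (t.1 (MvPolynomial.X i)).fst = x (phiHom π hl (MvPolynomial.X i)) := t.2 _
    rw [hs, show Z = Matrix.vecMulVec _ _ from rfl, charpoly_add_vecMulVec, charpolyVariation_smul,
      map_charpolyVariation, coeffVec, coeff_sub, coeff_C_mul, coeff_map, hπε, Matrix.charpoly_map, coeff_map] at h1
    rw [← hA, coeffVec, map_mul, map_pow, ← hp] at h2
    rw [coeffVec, neg_eq_iff_eq_neg] at h3
    rw [← h2, h3] at h1
    have hpu : IsUnit (f p ^ expo l₂ i) := ((IsUnit.mk0 p hπk).map f).pow _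
    refine hpu.mul_left_cancel ?_
    rw [h1, AlgHom.comp_apply, ← h4]
    change _ - TrivSqZeroExt.inr 1 * TrivSqZeroExt.inl _ = _
    rw [TrivSqZeroExt.inr_mul_inl, ← map_pow]
    change TrivSqZeroExt.inl _ * TrivSqZeroExt.inl _ - _ = TrivSqZeroExt.inl _ * _
    apply TrivSqZeroExt.ext <;> simp

end GenericPoint

theorem charpoly_eq_map_of_comp_eq {o k : Type*} [CommRing o] [IsDomain o] [CommRing k]
    [Nontrivial k] [Algebra o k] {π : o} {l₁ l₂ : ℕ} (hl : l₁ ≤ l₂) {φ : o[X]} (hφ : φ.Monic)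
    (hdeg : φ.natDegree = l₁ + l₂ + 2) (hc : coeffVec (l₁ + l₂ + 2) φ ∈ AffPoints π l₁ l₂ o)
    (x : EndRing o l₁ l₂ →ₐ[o] k)
    (hx : x.comp (phiHom π hl) = (Algebra.ofId o k).comp (affPoint π hc)) :
    ((universalMatrix π l₁ l₂).map x).charpoly = φ.map (algebraMap o k) := by
  have hdeg' : ((universalMatrix π l₁ l₂).map x).charpoly.natDegree = l₁ + l₂ + 2 := by
    rw [Matrix.charpoly_natDegree_eq_dim]
    simp [Idx]
  have hmonic := ((universalMatrix π l₁ l₂).map x).charpoly_monic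
  have hmap := hφ.map (algebraMap o k)
  have hmapdeg : (φ.map (algebraMap o k)).natDegree = l₁ + l₂ + 2 := by
    rw [hφ.natDegree_map, hdeg]
  have hcoeff : ∀ j < l₁ + l₂ + 2, ((universalMatrix π l₁ l₂).map x).charpoly.coeff j =
      (φ.map (algebraMap o k)).coeff j := by
    intro j hj
    have h1 := phiHom_spec π hl x ⟨l₁ + l₂ + 1 - j, by omega⟩
    have h2 := congrArg (algebraMap o k) (affPoint_spec π hc ⟨l₁ + l₂ + 1 - j, by omega⟩)
    have hj' : l₁ + l₂ + 2 - 1 - (l₁ + l₂ + 1 - j) = j := by omega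
    rw [hx] at h1
    rw [map_mul, map_pow] at h2
    simp only [coeffVec, hj'] at h1 h2
    rw [coeff_map]
    exact h1.symm.trans h2
  rw [← sub_eq_zero]
  ext j
  rcases lt_trichotomy j (l₁ + l₂ + 2) with hj | rfl | hj
  · rw [coeff_sub, hcoeff j hj, sub_self, coeff_zero]
  · rw [coeff_sub, ← hdeg', hmonic.coeff_natDegree, hdeg', ← hmapdeg, hmap.coeff_natDegree,
      sub_self, coeff_zero]
  · rw [coeff_sub, coeff_eq_zero_of_natDegree_lt (hdeg'.trans_lt hj),
      coeff_eq_zero_of_natDegree_lt (hmapdeg.trans_lt hj), sub_self, coeff_zero]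

/-- Over a finite, hence perfect, field an irreducible quadratic is separable and stays squarefree
after extension. Equality would turn it into `(X - μ) ^ 2`. Characteristic 2 needs no separate
treatment. -/
theorem ne_sq_of_irreducible_residue {o k : Type*} [CommRing o] [IsLocalRing o]
    [Finite (IsLocalRing.ResidueField o)] [Field k] [Algebra o k]
    [IsLocalHom (algebraMap o k)] {a b : o}
    (h : Irreducible (X ^ 2 + C (IsLocalRing.residue o a) * X + C (IsLocalRing.residue o b)))
    {μ : k} (ha : algebraMap o k a = -(2 * μ)) : algebraMap o k b ≠ μ ^ 2 := by
  intro hb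
  have hsep := (PerfectField.separable_of_irreducible h).map
    (f := IsLocalRing.ResidueField.lift (algebraMap o k))
  have heq : (X ^ 2 + C (IsLocalRing.residue o a) * X + C (IsLocalRing.residue o b)).map
      (IsLocalRing.ResidueField.lift (algebraMap o k)) = (X - C μ) * (X - C μ) := by
    simp only [Polynomial.map_add, Polynomial.map_mul, Polynomial.map_pow, map_X, map_C,
      IsLocalRing.ResidueField.lift_residue_apply, ha, hb]
    simp only [map_neg, map_mul, map_pow, C_ofNat]
    ring
  rw [heq] at hsep
  exact not_isUnit_X_sub_C μ (hsep.squarefree _ dvd_rfl)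

/-! ### Arithmetic input from the local field. -/

section LocalField

variable {F : Type u} [Field F] [ValuativeRel F] [TopologicalSpace F]
  [IsNonarchimedeanLocalField F] {π : 𝒪[F]} {φ : 𝒪[F][X]} {l₁ l₂ : ℕ}

/-- The segment joins heights `2` and `0`, so every coefficient below the leading one has positive
valuation. Those with index beyond `l₂ + 1 ≥ n / 2` lie above height 1 and are divisible by `π ^ 2`.
-/
theorem coeffVec_mem_affPoints (hπ : Irreducible π) (hmonic : φ.Monic) (hirr : Irreducible φ)
    (hdeg : φ.natDegree = l₁ + l₂ + 2)
    (hord : IsDiscreteValuationRing.addVal 𝒪[F] (φ.coeff 0) = 2) (hl : l₁ ≤ l₂) :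
    coeffVec (l₁ + l₂ + 2) φ ∈ AffPoints π l₁ l₂ 𝒪[F] := by
  intro i
  have hi := i.2
  refine pow_dvd_coeff_of_irreducible hπ hmonic hirr (d := 2) (by exact_mod_cast hord) ?_ ?_ <;>
    rw [hdeg]
  · omega
  · rw [expo]
    split_ifs <;> omega

theorem tangentMap_surjective_of_algebraMap_eq_zero (hπ : Irreducible π) (hmonic : φ.Monic)
    (hirr : Irreducible φ) (hdeg : φ.natDegree = l₁ + l₂ + 2)
    (hord : IsDiscreteValuationRing.addVal 𝒪[F] (φ.coeff 0) = 2)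
    (hres : l₁ = l₂ → ∀ a b : 𝒪[F], φ.coeff (l₂ + 1) = π * a → φ.coeff 0 = π ^ 2 * b →
      Irreducible (X ^ 2 + C (IsLocalRing.residue 𝒪[F] a) * X + C (IsLocalRing.residue 𝒪[F] b)))
    (h₁ : 0 < l₁) (hl : l₁ ≤ l₂) (hc : coeffVec (l₁ + l₂ + 2) φ ∈ AffPoints π l₁ l₂ 𝒪[F])
    {k : Type*} [Field k] [Algebra 𝒪[F] k] (hπk : algebraMap 𝒪[F] k π = 0)
    (x : EndRing 𝒪[F] l₁ l₂ →ₐ[𝒪[F]] k)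
    (hx : x.comp (phiHom π hl) = (Algebra.ofId 𝒪[F] k).comp (affPoint π hc)) :
    Function.Surjective (tangentMap (phiHom π hl) x) := by
  have hx' : ∀ i, x (phiHom π hl (MvPolynomial.X i)) =
      algebraMap 𝒪[F] k (affPoint π hc (MvPolynomial.X i)) := fun i =>
    DFunLike.congr_fun hx (MvPolynomial.X i)
  set b := affPoint π hc (MvPolynomial.X (Fin.last (l₁ + l₂ + 1))) with hb
  set a := affPoint π hc (MvPolynomial.X ⟨l₂, by omega⟩) with ha
  have hb' : π ^ 2 * b = φ.coeff 0 := by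
    have := affPoint_spec π hc (Fin.last (l₁ + l₂ + 1))
    rw [expo, if_neg (by simp only [Fin.val_last]; omega), coeffVec] at this
    simpa using this
  have ha' : π * a = φ.coeff (l₁ + 1) := by
    have := affPoint_spec π hc ⟨l₂, by omega⟩
    rw [expo, if_pos le_rfl, coeffVec, pow_one] at this
    rw [show l₁ + 1 = l₁ + l₂ + 2 - 1 - l₂ by omega]
    exact this
  -- Exact valuation 2 of the constant term makes `c_n / π²` a unit.
  have hbu : IsUnit b := by
    rw [← IsDiscreteValuationRing.addVal_eq_zero_iff]
    rw [← hb', IsDiscreteValuationRing.addVal_mul, IsDiscreteValuationRing.addVal_pow,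
      IsDiscreteValuationRing.addVal_uniformizer hπ] at hord
    cases hv : IsDiscreteValuationRing.addVal 𝒪[F] b with
    | top => rw [hv] at hord; simp at hord
    | coe v =>
      rw [hv] at hord
      norm_num at hord
      norm_cast at hord ⊢
  refine tangentMap_surjective_special hπ.ne_zero hπk hl h₁ x ?_ ?_ ?_
  · rw [hx']
    exact (hbu.map _).ne_zero
  · intro hlt
    rw [hx', ← ha]
    -- When `l₁ < l₂`, the coefficient `c_{l₂ + 1}` sits strictly above height 1 on the Newton
    -- polygon, so its quotient by `π` vanishes in `k`.
    have h1 : π ^ 2 ∣ φ.coeff (l₁ + 1) :=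
      pow_dvd_coeff_of_irreducible hπ hmonic hirr (d := 2) (by exact_mod_cast hord) (by omega)
        (by omega)
    rw [← ha', pow_two] at h1
    obtain ⟨c, hc⟩ := (mul_dvd_mul_iff_left hπ.ne_zero).mp h1
    rw [hc, map_mul, hπk, zero_mul]
  · intro heq μ hμ
    rw [hx', ← ha] at hμ
    rw [hx', ← hb]
    -- A non-unit is divisible by `π` and dies in `k`; hence the residue field maps to `k`.
    have : IsLocalHom (algebraMap 𝒪[F] k) := by
      refine ⟨fun c hcu => ?_⟩
      by_contra hcn
      have h1 : π ∣ c := by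
        rw [← Ideal.mem_span_singleton, ← hπ.maximalIdeal_eq]
        exact (IsLocalRing.mem_maximalIdeal c).mpr hcn
      obtain ⟨y, rfl⟩ := h1
      rw [map_mul, hπk, zero_mul] at hcu
      exact not_isUnit_zero hcu
    exact ne_sq_of_irreducible_residue
      (hres heq a b (by rw [ha', heq]) hb'.symm) hμ

theorem algebraMap_injective_of_ne_zero (hπ : Irreducible π) {k : Type*} [Field k]
    [Algebra 𝒪[F] k] (hπk : algebraMap 𝒪[F] k π ≠ 0) :
    Function.Injective (algebraMap 𝒪[F] k) := by
  rw [injective_iff_map_eq_zero]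
  intro c hc
  by_contra hne
  obtain ⟨n, v, rfl⟩ := IsDiscreteValuationRing.eq_unit_mul_pow_irreducible hne hπ
  rw [map_mul, map_pow] at hc
  exact mul_ne_zero (v.isUnit.map _).ne_zero (pow_ne_zero n hπk) hc

theorem separable_map_of_algebraMap_ne_zero (hπ : Irreducible π) {k : Type*} [Field k]
    [Algebra 𝒪[F] k] (hπk : algebraMap 𝒪[F] k π ≠ 0)
    (hsep : (φ.map (algebraMap 𝒪[F] F)).Separable) : (φ.map (algebraMap 𝒪[F] k)).Separable := by
  have hinj := algebraMap_injective_of_ne_zero hπ hπk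
  have h := hsep.map (f := IsFractionRing.lift hinj)
  have hcomp : (IsFractionRing.lift hinj : F →+* k).comp (algebraMap 𝒪[F] F) =
      algebraMap 𝒪[F] k := RingHom.ext fun c => IsFractionRing.lift_algebraMap hinj c
  rwa [Polynomial.map_map, hcomp] at h

end LocalField

end Smoothening

theorem mainTheorem9 {F : Type u} [Field F] [ValuativeRel F] [TopologicalSpace F]
    [IsNonarchimedeanLocalField F]
    (π : 𝒪[F]) (hπ : Irreducible π)
    (n : ℕ) (hn : 4 ≤ n)
    (φ : 𝒪[F][X]) (hmonic : φ.Monic) (hirr : Irreducible φ) (hdeg : φ.natDegree = n)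
    (hord : IsDiscreteValuationRing.addVal 𝒪[F] (φ.eval 0) = 2)
    (hres : Even n → ∀ a b : 𝒪[F], φ.coeff (n / 2) = π * a → φ.coeff 0 = π ^ 2 * b →
      Irreducible (X ^ 2 + C (IsLocalRing.residue 𝒪[F] a) * X + C (IsLocalRing.residue 𝒪[F] b)))
    (l₁ l₂ : ℕ) (hl₁ : 0 < l₁) (hl : l₁ ≤ l₂) (hln : l₁ + l₂ + 2 = n) :
    ∃ hφ : Smoothening.coeffVec (l₁ + l₂ + 2) φ ∈ Smoothening.AffPoints π l₁ l₂ 𝒪[F],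
      (∀ m : Smoothening.EndRing 𝒪[F] l₁ l₂ →ₐ[𝒪[F]] AlgebraicClosure 𝓀[F],
        m.comp (Smoothening.phiHom π hl) =
          (Algebra.ofId 𝒪[F] (AlgebraicClosure 𝓀[F])).comp (Smoothening.affPoint π hφ) →
        Function.Surjective (Smoothening.tangentMap (Smoothening.phiHom π hl) m)) ∧
      ((φ.map (algebraMap 𝒪[F] F)).Separable →
        AlgebraicGeometry.Smooth (Smoothening.fiberToSpec π hl hφ)) := by
  subst hln
  rw [← coeff_zero_eq_eval_zero] at hord
  have hres' : l₁ = l₂ → ∀ a b : 𝒪[F], φ.coeff (l₂ + 1) = π * a → φ.coeff 0 = π ^ 2 * b →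
      Irreducible (X ^ 2 + C (IsLocalRing.residue 𝒪[F] a) * X +
        C (IsLocalRing.residue 𝒪[F] b)) := by
    intro heq a b ha
    exact hres ⟨l₂ + 1, by omega⟩ a b (by rwa [show (l₁ + l₂ + 2) / 2 = l₂ + 1 by omega])
  refine ⟨Smoothening.coeffVec_mem_affPoints hπ hmonic hirr hdeg hord hl, fun m hm => ?_,
    fun hsep => ?_⟩
  · refine Smoothening.tangentMap_surjective_of_algebraMap_eq_zero hπ hmonic hirr hdeg hord hres'
      hl₁ hl _ ?_ m hm
    rw [IsScalarTower.algebraMap_apply 𝒪[F] 𝓀[F], IsLocalRing.ResidueField.algebraMap_eq,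
      (IsLocalRing.residue_eq_zero_iff π).mpr ((IsLocalRing.mem_maximalIdeal π).mpr hπ.1), map_zero]
  · refine Smoothening.smooth_pullback_of_tangentMap_surjective (Smoothening.phiHom π hl) _
      fun K _ _ _ x hx => ?_
    -- A geometric point of the fiber lies over the closed or the generic point of the base
    -- according to whether `π` vanishes in `K`; only the generic case needs separability of `φ`.
    by_cases hπK : algebraMap 𝒪[F] K π = 0
    · exact Smoothening.tangentMap_surjective_of_algebraMap_eq_zero hπ hmonic hirr hdeg hord hres'
        hl₁ hl _ hπK x hx
    · refine Smoothening.tangentMap_surjective_generic hπK hl x ?_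
      rw [Smoothening.charpoly_eq_map_of_comp_eq hl hmonic hdeg _ x hx]
      exact Smoothening.separable_map_of_algebraMap_ne_zero hπ hπK hsep
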